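/- **Setting.** Let $T$ (times) and $X$ (locations) be compact metric spaces, e.g. $T=[0,10]$, $X=[0,1]$, let $\Theta\subseteq\mathbb R^{k}$ be open, $\Theta_{ad}\subset\Theta$ compact and $\theta_0\in\operatorname{int}\Theta_{ad}$. For $M,N\in\mathbb N$ let $t_1,\dots,t_M\in T$, $x_1,\dots,x_N\in X$ be design points (they may depend on $M$, resp. $N$; e.g. uniform partitions). The data are $y_{ij}=u_0(t_i,x_j;\theta_0)+\epsilon_{ij}$ with $\epsilon_{ij}$ i.i.d. $\mathcal N(0,\eta^2)$, $\eta\ge 0$. Here $u_0(t,x;\theta)$ is the exact solution; it is $C^2$ in $\theta\in\Theta$, the continuity in $\theta$ of $u_0$ and of its first two $\theta$-derivatives being uniform in $(t,x)$. For a step size $h>0$ let $u(t,x;h,\theta)$ be the numerical solution, differentiable in $\theta$ for small $h$, and let $\hat\theta^{M,N}_{OLS}(h)$ be a (measurable) minimizer over $\Theta_{ad}$ of $J^{M,N}(h,\theta)=\frac1{MN}\sum_{i,j}(y_{ij}-u(t_i,x_j;h,\theta))^2$. Let $\nabla_\theta U_0(\theta_0)$ and $\nabla_\theta U(h,\theta_0)$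 be the $MN\times k$ matrices with rows $\nabla_\theta u_0(t_i,x_j;\theta_0)$ and $\nabla_\theta u(t_i,x_j;h,\theta_0)$, and put $$V=(\nabla_\theta U_0(\theta_0)^T\nabla_\theta U_0(\theta_0))^{-1},\qquad V_h=(\nabla_\theta U(h,\theta_0)^T\nabla_\theta U(h,\theta_0))^{-1}.$$ **Assumptions.** A numerical quantity $q(t,x;h,\theta)$ has *order* $p>0$ for $q_0(t,x;\theta)$ if for every compact $K\subset\Theta$ one has $q=q_0+h^p w$ for $\theta\in K$ and all small $h$, with $w$ bounded uniformly in $(t,x)$, $\theta\in K$ and small $h$, and if for small $h$ the map $\theta\mapsto q(\cdot;h,\theta)\in L^1$ is continuous. Assume that $u$ has order $p$ for $u_0$ and that each component of $\nabla_\theta u$ has order $p$ for the same component of $\nabla_\theta u_0$. Assume moreover: * (A1) there are finite measures $\nu$ on $T$ and $\chi$ on $X$ with $\frac1{MN}\sum_{i,j}v(t_i,x_j)\to\int_X\int_T v\,d\nu\,d\chi$ as $M,N\to\infty$, for every bounded $v:T\times X\to\mathbb R$ that is continuous at $\nu\otimes\chi$-almost every point; the functions $u_0(\cdot;\theta)$,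 $\theta\in\Theta$, and the components of $\nabla_\theta u_0(\cdot;\theta_0)$ are of this kind; * (A2) $J^*(\theta)=\int_X\int_T(u_0(t,x;\theta_0)-u_0(t,x;\theta))^2\,d\nu\,d\chi$ has on $\Theta_{ad}$ the unique minimizer $\theta_0$; * $\int_X\int_T\nabla_\theta u_0(t,x;\theta_0)\nabla_\theta u_0(t,x;\theta_0)^T\,d\nu\,d\chi$, the limit of $(MN\,V)^{-1}$, is nonsingular. **Conclusion.** $\hat\theta^{M,N}_{OLS}(h)$ is asymptotically $\mathcal N(\theta_0,\eta^2V_h)$, in the following sense, where two families of probability laws on $\mathbb R^k$ are said to merge if the difference of the integrals of each bounded continuous function against them tends to $0$: 1. the laws of $\hat\theta^{M,N}_{OLS}(h)$ and $\mathcal N(\theta_0,\eta^2V_h)$ merge as $M,N\to\infty$ and $h\to0$ jointly, without restriction; 2. on the scale of the standard deviations, the laws of $\sqrt{MN}\,(\hat\theta^{M,N}_{OLS}(h)-\theta_0)$ and $\mathcal N(0,MN\,\eta^2V_h)$ merge as first $h\to0$ and then $M,N\to\infty$ (for every bounded continuous $f$ and $\delta>0$: for all sufficiently large $M,N$ and then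 all sufficiently small $h$ the two integrals of $f$ differ by less than $\delta$); 3. the laws in 2. also merge along all sequences $M,N\to\infty$, $h\to0$ with $\sqrt{MN}\,h^p\to0$. Moreover the entries of $V_h$ converge to those of $V$ at the rate $O(h^p)$: for all $M,N$ for which $V$ exists, $V_h$ exists for all small $h$ and $(V_h)_{lm}-V_{lm}=O(h^p)$ as $h\to0$ for all $l,m$; and there are $C$ and $h_*>0$ such that for all sufficiently large $M,N$ and all $0<h<h_*$, $V$ and $V_h$ exist and $MN\,|(V_h)_{lm}-V_{lm}|\le C h^p$ for all $l,m$. -/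

import Mathlib

open MeasureTheory ProbabilityTheory Filter Topology
open scoped NNReal BoundedContinuousFunction

noncomputable section

namespace NumericalOLS

/-- The ambient parameter space `ℝᵏ` with the Euclidean norm. -/
abbrev Param (k : ℕ) : Type := EuclideanSpace ℝ (Fin k)

/-- The sensitivity of a real quantity `f` to the `l`-th parameter: the partial derivative
`∂f/∂θ_l` at `θ`. -/
def sens {k : ℕ} (f : Param k → ℝ) (l : Fin k) (θ : Param k) : ℝ :=
  fderiv ℝ f θ (EuclideanSpace.single l 1)

/-- Riemann integrability with respect to `μ`: bounded and continuous at `μ`-almost every point. -/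
def RiemannIntegrable {Z : Type*} [TopologicalSpace Z] [MeasurableSpace Z]
    (v : Z → ℝ) (μ : Measure Z) : Prop :=
  (∃ B : ℝ, ∀ z, |v z| ≤ B) ∧ ∀ᵐ z ∂μ, ContinuousAt v z

/-- The model `v (t, x) θ` is sufficiently smooth in `θ` on the open set `Θ`: it is twice
continuously differentiable there, the continuity of the model and of its first two derivatives
being uniform over the points `(t, x)`. -/
def SmoothInParam {Z : Type*} {k : ℕ} (Θ : Set (Param k)) (v : Z → Param k → ℝ) : Prop :=
  (∀ z, ContDiffOn ℝ 2 (v z) Θ) ∧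
  ∀ m : ℕ, m ≤ 2 → EquicontinuousOn (fun z θ => iteratedFDeriv ℝ m (v z) θ) Θ

/-- The numerical quantity `u h z θ` (computed with step size `h`) approximates `u₀ z θ` with
order of convergence `p`: on every compact set `K` of parameters `u = u₀ + h ^ p * w`, where `w` is
bounded uniformly for small `h`; and for small `h` the map `θ ↦ u h · θ` is continuous into `L¹`. -/
def HasOrder {Z : Type*} [MeasurableSpace Z] {k : ℕ} (μ : Measure Z) (p : ℝ)
    (Θ : Set (Param k)) (u : ℝ → Z → Param k → ℝ) (u₀ : Z → Param k → ℝ) : Prop :=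
  0 < p ∧
  (∀ K : Set (Param k), K ⊆ Θ → IsCompact K →
    ∃ (w : ℝ → Z → Param k → ℝ) (C h₀ : ℝ), 0 < h₀ ∧
      ∀ h, 0 < h → h < h₀ → ∀ θ ∈ K, ∀ z,
        u h z θ = u₀ z θ + h ^ p * w h z θ ∧ |w h z θ| ≤ C) ∧
  (∀ᶠ h in 𝓝[>] (0 : ℝ), ∀ θ ∈ Θ, Integrable (fun z => u h z θ) μ ∧
    Tendsto (fun θ' => ∫ z, |u h z θ' - u h z θ| ∂μ) (𝓝[Θ] θ) (𝓝 0))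

section Design

variable {T X : Type*}

/-- The point `(t_i, x_j)` of the `M × N` design: `t M` lists the `M` observation times and `x N`
the `N` observation locations. -/
def gridPt (t : ∀ M : ℕ, Fin M → T) (x : ∀ N : ℕ, Fin N → X) (M N : ℕ)
    (r : Fin M × Fin N) : T × X :=
  (t M r.1, x N r.2)

/-- Averages over the design converge to integrals against `ν ⊗ χ`. -/
def DesignConverges [TopologicalSpace T] [TopologicalSpace X] [MeasurableSpace T]
    [MeasurableSpace X] (t : ∀ M : ℕ, Fin M → T) (x : ∀ N : ℕ, Fin N → X)
    (ν : Measure T) (χ : Measure X) : Prop :=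
  ∀ v : T × X → ℝ, RiemannIntegrable v (ν.prod χ) →
    Tendsto (fun MN : ℕ × ℕ => (1 / ((MN.1 : ℝ) * MN.2)) *
        ∑ i : Fin MN.1, ∑ j : Fin MN.2, v (gridPt t x MN.1 MN.2 (i, j)))
      (atTop ×ˢ atTop) (𝓝 (∫ z, v z ∂(ν.prod χ)))

variable {k : ℕ}

/-- The limiting cost functional `J*(θ)`. -/
def limitCost [MeasurableSpace T] [MeasurableSpace X] (ν : Measure T) (χ : Measure X)
    (u₀ : T × X → Param k → ℝ) (θ₀ θ : Param k) : ℝ :=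
  ∫ z, (u₀ z θ₀ - u₀ z θ) ^ 2 ∂(ν.prod χ)

/-- The limit of `(1 / MN) ∇U₀(θ)ᵀ ∇U₀(θ)`: the matrix of integrals of products of
sensitivities. -/
def limitGram [MeasurableSpace T] [MeasurableSpace X] (ν : Measure T) (χ : Measure X)
    (u₀ : T × X → Param k → ℝ) (θ : Param k) : Matrix (Fin k) (Fin k) ℝ :=
  Matrix.of fun l m => ∫ z, sens (u₀ z) l θ * sens (u₀ z) m θ ∂(ν.prod χ)

/-- The `MN × k` sensitivity matrix `∇_θ U(θ)` of the model `v` on the `M × N` design. -/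
def sensMatrix (t : ∀ M : ℕ, Fin M → T) (x : ∀ N : ℕ, Fin N → X)
    (v : T × X → Param k → ℝ) (θ : Param k) (M N : ℕ) :
    Matrix (Fin M × Fin N) (Fin k) ℝ :=
  Matrix.of fun r l => sens (v (gridPt t x M N r)) l θ

/-- `∇_θ U(θ)ᵀ ∇_θ U(θ)`. -/
def gram (t : ∀ M : ℕ, Fin M → T) (x : ∀ N : ℕ, Fin N → X)
    (v : T × X → Param k → ℝ) (θ : Param k) (M N : ℕ) : Matrix (Fin k) (Fin k) ℝ :=
  (sensMatrix t x v θ M N).transpose * sensMatrix t x v θ M N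

/-- `(∇_θ U(θ)ᵀ ∇_θ U(θ))⁻¹`: the matrix `V` when `v = u₀`, and `V_h` when `v = u h`. -/
def covMat (t : ∀ M : ℕ, Fin M → T) (x : ∀ N : ℕ, Fin N → X)
    (v : T × X → Param k → ℝ) (θ : Param k) (M N : ℕ) : Matrix (Fin k) (Fin k) ℝ :=
  (gram t x v θ M N)⁻¹

/-- The OLS cost of the model `v` for the `M × N` data set `Y`. -/
def olsCost (t : ∀ M : ℕ, Fin M → T) (x : ∀ N : ℕ, Fin N → X)
    (v : T × X → Param k → ℝ) {M N : ℕ} (Y : Matrix (Fin M) (Fin N) ℝ) (θ : Param k) : ℝ :=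
  (1 / ((M : ℝ) * N)) * ∑ i : Fin M, ∑ j : Fin N, (Y i j - v (gridPt t x M N (i, j)) θ) ^ 2

/-- `θ'` is an OLS estimate: a minimizer of the OLS cost over the admissible set. -/
def IsOLS (t : ∀ M : ℕ, Fin M → T) (x : ∀ N : ℕ, Fin N → X)
    (v : T × X → Param k → ℝ) (Θad : Set (Param k)) {M N : ℕ}
    (Y : Matrix (Fin M) (Fin N) ℝ) (θ' : Param k) : Prop :=
  θ' ∈ Θad ∧ IsMinOn (olsCost t x v Y) Θad θ'

/-- The statistical model: `y_{i,j} = u₀(t_i, x_j; θ₀) + ε_{i,j}`. -/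
def data {Ω : Type*} (t : ∀ M : ℕ, Fin M → T) (x : ∀ N : ℕ, Fin N → X)
    (u₀ : T × X → Param k → ℝ) (θ₀ : Param k) (ε : ℕ → ℕ → Ω → ℝ) (M N : ℕ) (ω : Ω) :
    Matrix (Fin M) (Fin N) ℝ :=
  Matrix.of fun i j => u₀ (gridPt t x M N (i, j)) θ₀ + ε i j ω

end Design

/-- The error `|E f(Y) - ∫ f dρ|` made on the test function `f` when the law of the random vector
`Y` is replaced by `ρ`. -/
def lawGap {Ω : Type*} [MeasurableSpace Ω] {k : ℕ} (P : Measure Ω) (Y : Ω → Param k)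
    (ρ : Measure (Param k)) (f : Param k →ᵇ ℝ) : ℝ :=
  |(∫ ω, f (Y ω) ∂P) - ∫ y, f y ∂ρ|

end NumericalOLS

end

/-! In every claim the two laws share a weak limit. Write n = MN and let G be the limit of n⁻¹ times
the Gram matrix of `u₀` at θ₀. Its numerical counterpart differs from it by O(h^p), so n V_h → G⁻¹
jointly in the design and the step size, by continuity of matrix inversion. Hence N(0, n η² V_h)
tends to N(0, η² G⁻¹), while N(θ₀, η² V_h) collapses to the point mass at θ₀. Since inversion is
even Lipschitz near an invertible matrix, the O(h^p) bound passes to V_h, for one design and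
uniformly after normalization.

The unscaled claim thus needs only consistency (`tendsto_measureReal_estimator_sub`), and no rate
for h. A minimizer fits the data at least as well as θ₀ does. Near a wrong parameter θ this forces
the mean squared difference of the models to be small with high probability, whereas by (A1) and
(A2) it tends to J*(θ) > 0. Compactness of the admissible set reduces the argument to finitely many
θ.

For the scaled claims (`tendsto_measureReal_sub_leadingTerm`), consistency puts the estimator in the
interior, where the normal equations hold. Replacing `u` and its sensitivities by those of `u₀`
costs O(h^p), and linearizing at θ₀ gives √n (θhat - θ₀) = G⁻¹ n^(-1/2) ∑ ε ∇u₀(θ₀) + o_P(1) as soon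
as √n h^p → 0. The leading term is linear in Gaussian noise, so no central limit theorem is needed:
it is exactly Gaussian with covariance η² G⁻¹ (Gram / n) G⁻¹, which tends to η² G⁻¹. Lévy's theorem
and Slutsky's argument (`tendsto_lawGap`) conclude.

The iterated limit and the restricted joint limit are two readings of one convergence, along the
filter of large designs and small steps refined by the condition √n h^p → 0. -/

namespace NumericalOLS

/-! ### Weak convergence: Lévy, Gaussian laws, Slutsky -/

section WeakConvergence

variable {E : Type*} [NormedAddCommGroup E] [InnerProductSpace ℝ E] [FiniteDimensional ℝ E]
  [MeasurableSpace E] [BorelSpace E]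

/-- Lévy's continuity theorem along a countably generated filter. -/
lemma tendsto_probabilityMeasure_of_charFun {ι : Type*} {l : Filter ι} [l.IsCountablyGenerated]
    {μ : ι → ProbabilityMeasure E} {μ₀ : ProbabilityMeasure E}
    (h : ∀ s : E, Tendsto (fun i => charFun (μ i : Measure E) s) l
      (𝓝 (charFun (μ₀ : Measure E) s))) :
    Tendsto μ l (𝓝 μ₀) :=
  tendsto_of_seq_tendsto fun _ hq =>
    ProbabilityMeasure.tendsto_of_tendsto_charFun fun s => (h s).comp hq

/-- The characteristic function is the exponential of a continuous function of the covariance.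
Singular covariances are admitted, so that the limit may be a point mass. -/
lemma tendsto_multivariateGaussian {ι : Type*} {l : Filter ι} [l.IsCountablyGenerated] {k : ℕ}
    (m : Param k) {S : ι → Matrix (Fin k) (Fin k) ℝ} {S₀ : Matrix (Fin k) (Fin k) ℝ}
    (hS : Tendsto S l (𝓝 S₀)) (hpos : ∀ i, (S i).PosSemidef) (hpos₀ : S₀.PosSemidef)
    (f : Param k →ᵇ ℝ) :
    Tendsto (fun i => ∫ y, f y ∂(multivariateGaussian m (S i))) l
      (𝓝 (∫ y, f y ∂(multivariateGaussian m S₀))) := by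
  have key : Tendsto (β := ProbabilityMeasure (Param k))
      (fun i => ⟨multivariateGaussian m (S i), inferInstance⟩) l
      (𝓝 ⟨multivariateGaussian m S₀, inferInstance⟩) := by
    refine tendsto_probabilityMeasure_of_charFun fun s => ?_
    simp only [ProbabilityMeasure.coe_mk, charFun_multivariateGaussian (hpos _),
      charFun_multivariateGaussian hpos₀]
    refine (Complex.continuous_exp.tendsto _).comp (Tendsto.sub tendsto_const_nhds ?_)
    refine Tendsto.div_const ?_ _
    refine (Complex.continuous_ofReal.tendsto _).comp ?_
    have hc : Continuous fun A : Matrix (Fin k) (Fin k) ℝ =>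
        s.ofLp ⬝ᵥ (A.mulVec s.ofLp) := by fun_prop
    exact (hc.tendsto S₀).comp hS
  exact (ProbabilityMeasure.tendsto_iff_forall_integral_tendsto.1 key) f

/-- If `Y - X → 0` in probability, and the laws of `X` and the measures `ρ` have the same weak
limit, then the laws of `Y` and `ρ` merge. -/
lemma tendsto_lawGap {Ω ι : Type*} [MeasurableSpace Ω] {P : Measure Ω} [IsProbabilityMeasure P]
    {l : Filter ι} [l.IsCountablyGenerated] {k : ℕ} {X Y : ι → Ω → Param k}
    {ρ : ι → Measure (Param k)} {ρ₀ : Measure (Param k)} [IsProbabilityMeasure ρ₀]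
    (hX : ∀ i, AEMeasurable (X i) P) (hY : ∀ᶠ i in l, AEMeasurable (Y i) P)
    (hXρ : ∀ s, Tendsto (fun i => charFun (P.map (X i)) s) l (𝓝 (charFun ρ₀ s)))
    (hsub : ∀ γ > 0, Tendsto (fun i => P.real {ω | γ ≤ ‖Y i ω - X i ω‖}) l (𝓝 0))
    (f : Param k →ᵇ ℝ)
    (hρ : Tendsto (fun i => ∫ y, f y ∂(ρ i)) l (𝓝 (∫ y, f y ∂ρ₀))) :
    Tendsto (fun i => lawGap P (Y i) (ρ i) f) l (𝓝 0) := by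
  classical
  -- Convergence in distribution asks for measurability at every index, but `Y i` has it only
  -- eventually; elsewhere `X i` stands in.
  let Y' : ι → Ω → Param k := fun i => if AEMeasurable (Y i) P then Y i else X i
  have hYY' : ∀ᶠ i in l, Y' i = Y i := by
    filter_upwards [hY] with i hi
    simp [Y', hi]
  have hY' : ∀ i, AEMeasurable (Y' i) P := fun i => by
    by_cases h : AEMeasurable (Y i) P
    · simp [Y', h]
    · simpa [Y', h] using hX i
  have hdist : TendstoInDistribution X l (id : Param k → Param k) (fun _ => P) ρ₀ := by
    refine ⟨hX, aemeasurable_id, ?_⟩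
    refine tendsto_probabilityMeasure_of_charFun fun s => ?_
    simpa using hXρ s
  have hmeas : TendstoInMeasure P (Y' - X) l 0 := by
    rw [tendstoInMeasure_iff_measureReal_norm]
    intro γ hγ
    refine (hsub γ hγ).congr' ?_
    filter_upwards [hYY'] with i hi
    simp [hi]
  have hconv := tendstoInDistribution_of_tendstoInMeasure_sub Y' id hdist hmeas hY'
  have h1 := (ProbabilityMeasure.tendsto_iff_forall_integral_tendsto.1 hconv.tendsto) f
  simp only [ProbabilityMeasure.coe_mk, Measure.map_id] at h1
  have h2 : Tendsto (fun i => (∫ ω, f (Y i ω) ∂P) - ∫ y, f y ∂(ρ i)) l (𝓝 0) := by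
    have := h1.sub hρ
    rw [sub_self] at this
    refine this.congr' ?_
    filter_upwards [hYY'] with i hi
    rw [integral_map (hY' i) f.continuous.aestronglyMeasurable, hi]
  simpa [lawGap] using h2.abs

end WeakConvergence

/-! ### Linear combinations of independent Gaussian noise -/

section Noise

lemma memLp_of_hasLaw_gaussianReal {Ω : Type*} [MeasurableSpace Ω] {P : Measure Ω}
    {X : Ω → ℝ} {m : ℝ} {v : ℝ≥0}
    (h : HasLaw X (gaussianReal m v) P) : MemLp X 2 P := by
  have : MemLp id 2 (P.map X) := by
    rw [h.map_eq]; exact memLp_id_gaussianReal 2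
  exact (memLp_map_measure_iff this.1 h.aemeasurable).1 this

variable {Ω ι : Type*} [MeasurableSpace Ω] {P : Measure Ω} [IsProbabilityMeasure P] [Fintype ι]
  {η : ℝ≥0} {e : ι → Ω → ℝ}

lemma map_weightedSum_gaussian (hlaw : ∀ i, HasLaw (e i) (gaussianReal 0 (η ^ 2)) P)
    (hindep : iIndepFun e P) (a : ι → ℝ) :
    P.map (fun ω => ∑ i, a i * e i ω) =
      gaussianReal 0 ((η : ℝ) ^ 2 * ∑ i, a i ^ 2).toNNReal := by
  have hg : ∀ i, HasGaussianLaw (e i) P := fun i => ⟨by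
    rw [(hlaw i).map_eq]; infer_instance⟩
  have hind' : iIndepFun (fun i ω => a i * e i ω) P :=
    hindep.comp (fun i y => a i * y) fun i => measurable_const_mul _
  have hg' : ∀ i, HasGaussianLaw (fun ω => a i * e i ω) P := fun i => by
    simpa using (hg i).fun_smul (a i)
  have hsum := iIndepFun.hasGaussianLaw_fun_sum hg' hind'
  have hmem : ∀ i, MemLp (fun ω => a i * e i ω) 2 P := fun i =>
    (memLp_of_hasLaw_gaussianReal (hlaw i)).const_mul _
  rw [hsum.map_eq_gaussianReal]
  congr 1
  · rw [integral_finsetSum _ fun i _ => (hmem i).integrable (by norm_num)]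
    refine Finset.sum_eq_zero fun i _ => ?_
    rw [integral_const_mul, (hlaw i).integral_eq]
    simp
  · have hv : Var[fun ω => ∑ i, a i * e i ω; P] = η ^ 2 * ∑ i, a i ^ 2 := by
      have := IndepFun.variance_sum (μ := P) (s := Finset.univ) (X := fun i ω => a i * e i ω)
        (fun i _ => hmem i) (fun i _ j _ hij => hind'.indepFun hij)
      have hfun : (fun ω => ∑ i, a i * e i ω) = ∑ i, fun ω => a i * e i ω := by
        ext ω; simp
      rw [hfun, this, Finset.mul_sum]
      refine Finset.sum_congr rfl fun i _ => ?_
      rw [variance_const_mul, (hlaw i).variance_eq, variance_id_gaussianReal]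
      push_cast
      ring
    rw [hv]

/-- Chebyshev's inequality with the exact variance of the weighted sum. -/
lemma measureReal_weightedSum_ge_le (hlaw : ∀ i, HasLaw (e i) (gaussianReal 0 (η ^ 2)) P)
    (hindep : iIndepFun e P) (a : ι → ℝ) {c : ℝ} (hc : 0 < c) :
    P.real {ω | c ≤ |∑ i, a i * e i ω|} ≤ η ^ 2 * (∑ i, a i ^ 2) / c ^ 2 := by
  have hm : AEMeasurable (fun ω => ∑ i, a i * e i ω) P := by
    refine Finset.aemeasurable_fun_sum _ fun i _ => (hlaw i).aemeasurable.const_mul _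
  have hl : HasLaw (fun ω => ∑ i, a i * e i ω)
      (gaussianReal 0 ((η : ℝ) ^ 2 * ∑ i, a i ^ 2).toNNReal) P :=
    ⟨hm, map_weightedSum_gaussian hlaw hindep a⟩
  have h := meas_ge_le_variance_div_sq (memLp_of_hasLaw_gaussianReal hl) hc
  rw [hl.variance_eq, hl.integral_eq] at h
  simp only [variance_id_gaussianReal, integral_id_gaussianReal, sub_zero] at h
  have h' := ENNReal.toReal_mono (by simp) h
  rw [ENNReal.toReal_ofReal (by positivity), Real.coe_toNNReal _ (by positivity)] at h'
  exact h'

/-- Markov's inequality. -/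
lemma measureReal_sum_abs_ge_le (hlaw : ∀ i, HasLaw (e i) (gaussianReal 0 (η ^ 2)) P)
    {c : ℝ} (hc : 0 < c) :
    P.real {ω | c ≤ ∑ i, |e i ω|} ≤ Fintype.card ι * (∫ x, |x| ∂gaussianReal 0 (η ^ 2)) / c := by
  have hint : ∀ i, Integrable (fun ω => |e i ω|) P := fun i =>
    ((memLp_of_hasLaw_gaussianReal (hlaw i)).integrable (by norm_num)).abs
  have h := mul_meas_ge_le_integral_of_nonneg (μ := P) (f := fun ω => ∑ i, |e i ω|)
    (ae_of_all _ fun ω => Finset.sum_nonneg fun i _ => abs_nonneg _)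
    (integrable_finsetSum _ fun i _ => hint i) c
  rw [integral_finsetSum _ fun i _ => hint i] at h
  have heq : ∀ i, ∫ ω, |e i ω| ∂P = ∫ x, |x| ∂gaussianReal 0 (η ^ 2) := fun i => by
    rw [← (hlaw i).map_eq, integral_map (hlaw i).aemeasurable (by fun_prop)]
  simp only [heq, Finset.sum_const, Finset.card_univ, nsmul_eq_mul] at h
  rw [le_div_iff₀ hc, mul_comm]
  exact h

/-- Projecting on `s` reduces to the scalar weighted sum, whose characteristic function is evaluated
at 1. -/
lemma charFun_map_weightedSum {k : ℕ} (hlaw : ∀ i, HasLaw (e i) (gaussianReal 0 (η ^ 2)) P)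
    (hindep : iIndepFun e P) (c : ι → Param k) (s : Param k) :
    charFun (P.map (fun ω => ∑ i, e i ω • c i)) s =
      Complex.exp (-(((η : ℝ) ^ 2 * ∑ i, (inner ℝ (c i) s) ^ 2 : ℝ) : ℂ) / 2) := by
  have hm : AEMeasurable (fun ω => ∑ i, e i ω • c i) P :=
    Finset.aemeasurable_fun_sum _ fun i _ => (hlaw i).aemeasurable.smul_const _
  have hm' : AEMeasurable (fun ω => ∑ i, inner ℝ (c i) s * e i ω) P :=
    Finset.aemeasurable_fun_sum _ fun i _ => (hlaw i).aemeasurable.const_mul _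
  have h1 : charFun (P.map (fun ω => ∑ i, e i ω • c i)) s =
      charFun (P.map (fun ω => ∑ i, inner ℝ (c i) s * e i ω)) 1 := by
    rw [charFun_apply, charFun_apply, integral_map hm (by fun_prop), integral_map hm' (by fun_prop)]
    congr with ω
    simp [sum_inner, real_inner_smul_left, mul_comm]
  rw [h1, map_weightedSum_gaussian hlaw hindep, charFun_gaussianReal,
    Real.coe_toNNReal _ (by positivity)]
  congr 1
  push_cast
  simp [neg_div]

end Noise

/-! ### Differentiation in the parameter, uniformly over the points -/

section Calculus

variable {Z : Type*} {k : ℕ}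

lemma fderiv_apply_eq_sum_sens (f : Param k → ℝ) (θ v : Param k) :
    fderiv ℝ f θ v = ∑ m, v m * sens f m θ := by
  conv_lhs => rw [← (EuclideanSpace.basisFun (Fin k) ℝ).sum_repr v]
  simp [sens]

lemma abs_coord_le_norm (v : Param k) (m : Fin k) : |v m| ≤ ‖v‖ := by
  simpa using PiLp.norm_apply_le v m

/-- First-order Taylor expansion, uniform over a family with equicontinuous derivatives. -/
lemma taylor_one_uniform {f : Z → Param k → ℝ} {Θ : Set (Param k)} (hΘ : IsOpen Θ)
    {θ₀ : Param k} (hθ₀ : θ₀ ∈ Θ) (hf : ∀ z, DifferentiableOn ℝ (f z) Θ)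
    (heq : ∀ κ > 0, ∀ᶠ θ in 𝓝 θ₀, ∀ z, ‖fderiv ℝ (f z) θ - fderiv ℝ (f z) θ₀‖ ≤ κ)
    {κ : ℝ} (hκ : 0 < κ) :
    ∀ᶠ θ in 𝓝 θ₀, ∀ z,
      |f z θ - f z θ₀ - ∑ m, (θ - θ₀) m * sens (f z) m θ₀| ≤ κ * ‖θ - θ₀‖ := by
  obtain ⟨δ, hδ, hball⟩ := Metric.eventually_nhds_iff_ball.1
    ((heq κ hκ).and (hΘ.eventually_mem hθ₀))
  filter_upwards [Metric.ball_mem_nhds θ₀ hδ] with θ hθ z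
  rw [← fderiv_apply_eq_sum_sens, ← Real.norm_eq_abs]
  -- Mean value inequality for `f z` minus its linearization; the radius `δ` serves all `z` at once.
  exact (convex_ball θ₀ δ).norm_image_sub_le_of_norm_hasFDerivWithin_le'
    (fun x hx => (((hf z).differentiableAt
      (hΘ.mem_nhds (hball x hx).2)).hasFDerivAt).hasFDerivWithinAt)
    (fun x hx => (hball x hx).1 z) (Metric.mem_ball_self hδ) hθ

lemma SmoothInParam.eventually_norm_iteratedFDeriv_sub_le {Θ : Set (Param k)} (hΘ : IsOpen Θ)
    {v : Z → Param k → ℝ} (hv : SmoothInParam Θ v) {θ₀ : Param k} (hθ₀ : θ₀ ∈ Θ) {m : ℕ}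
    (hm : m ≤ 2) {κ : ℝ} (hκ : 0 < κ) :
    ∀ᶠ θ in 𝓝 θ₀, ∀ z, ‖iteratedFDeriv ℝ m (v z) θ - iteratedFDeriv ℝ m (v z) θ₀‖ ≤ κ := by
  have h := hv.2 m hm θ₀ hθ₀ _ (Metric.dist_mem_uniformity hκ)
  rw [hΘ.nhdsWithin_eq hθ₀] at h
  filter_upwards [h] with θ hθ z
  have := hθ z
  rw [dist_comm, dist_eq_norm] at this
  exact this.le

lemma SmoothInParam.eventually_abs_sub_le {Θ : Set (Param k)} (hΘ : IsOpen Θ)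
    {v : Z → Param k → ℝ} (hv : SmoothInParam Θ v) {θ₀ : Param k} (hθ₀ : θ₀ ∈ Θ)
    {κ : ℝ} (hκ : 0 < κ) :
    ∀ᶠ θ in 𝓝 θ₀, ∀ z, |v z θ - v z θ₀| ≤ κ := by
  filter_upwards [hv.eventually_norm_iteratedFDeriv_sub_le hΘ hθ₀ (m := 0) (by norm_num) hκ]
    with θ hθ z
  have h := (iteratedFDeriv ℝ 0 (v z) θ - iteratedFDeriv ℝ 0 (v z) θ₀).le_opNorm 0
  simp only [Finset.univ_eq_empty, Finset.prod_empty, mul_one, sub_apply,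
    iteratedFDeriv_zero_apply] at h
  exact h.trans (hθ z)

lemma SmoothInParam.eventually_norm_fderiv_sub_le {Θ : Set (Param k)} (hΘ : IsOpen Θ)
    {v : Z → Param k → ℝ} (hv : SmoothInParam Θ v) {θ₀ : Param k} (hθ₀ : θ₀ ∈ Θ)
    {κ : ℝ} (hκ : 0 < κ) :
    ∀ᶠ θ in 𝓝 θ₀, ∀ z, ‖fderiv ℝ (v z) θ - fderiv ℝ (v z) θ₀‖ ≤ κ := by
  filter_upwards [hv.eventually_norm_iteratedFDeriv_sub_le hΘ hθ₀ (m := 1) (by norm_num) hκ]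
    with θ hθ z
  refine ContinuousLinearMap.opNorm_le_bound _ hκ.le fun y => ?_
  have h := (iteratedFDeriv ℝ 1 (v z) θ - iteratedFDeriv ℝ 1 (v z) θ₀).le_opNorm fun _ => y
  simp only [Finset.univ_unique, Finset.prod_singleton, sub_apply,
    iteratedFDeriv_one_apply] at h
  exact h.trans (mul_le_mul_of_nonneg_right (hθ z) (norm_nonneg _))

lemma sens_sub_le (f : Param k → ℝ) (l : Fin k) (θ θ₀ : Param k) :
    |sens f l θ - sens f l θ₀| ≤ ‖fderiv ℝ f θ - fderiv ℝ f θ₀‖ := by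
  have := (fderiv ℝ f θ - fderiv ℝ f θ₀).le_opNorm (EuclideanSpace.single l 1)
  simpa [sens] using this

lemma SmoothInParam.differentiableOn_fderiv {Θ : Set (Param k)} (hΘ : IsOpen Θ)
    {v : Z → Param k → ℝ} (hv : SmoothInParam Θ v) (z : Z) :
    DifferentiableOn ℝ (fderiv ℝ (v z)) Θ :=
  ((hv.1 z).fderiv_of_isOpen hΘ (m := 1) (by norm_num)).differentiableOn (by norm_num)

lemma SmoothInParam.fderiv_sens {Θ : Set (Param k)} (hΘ : IsOpen Θ)
    {v : Z → Param k → ℝ} (hv : SmoothInParam Θ v) (z : Z) (l : Fin k) {θ : Param k}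
    (hθ : θ ∈ Θ) (y : Param k) :
    fderiv ℝ (sens (v z) l) θ y =
      iteratedFDeriv ℝ 2 (v z) θ ![y, EuclideanSpace.single l 1] := by
  have hd := ((hv.differentiableOn_fderiv hΘ z).differentiableAt (hΘ.mem_nhds hθ)).hasFDerivAt
  have := hd.clm_apply (hasFDerivAt_const (EuclideanSpace.single l (1 : ℝ)) θ)
  have h2 : fderiv ℝ (sens (v z) l) θ = _ := this.fderiv
  rw [h2, iteratedFDeriv_two_apply]
  simp

lemma SmoothInParam.differentiableOn_sens {Θ : Set (Param k)} (hΘ : IsOpen Θ)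
    {v : Z → Param k → ℝ} (hv : SmoothInParam Θ v) (z : Z) (l : Fin k) :
    DifferentiableOn ℝ (sens (v z) l) Θ :=
  (hv.differentiableOn_fderiv hΘ z).clm_apply (differentiableOn_const _)

lemma SmoothInParam.eventually_norm_fderiv_sens_sub_le {Θ : Set (Param k)} (hΘ : IsOpen Θ)
    {v : Z → Param k → ℝ} (hv : SmoothInParam Θ v) {θ₀ : Param k} (hθ₀ : θ₀ ∈ Θ) (l : Fin k)
    {κ : ℝ} (hκ : 0 < κ) :
    ∀ᶠ θ in 𝓝 θ₀, ∀ z, ‖fderiv ℝ (sens (v z) l) θ - fderiv ℝ (sens (v z) l) θ₀‖ ≤ κ := by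
  filter_upwards [hv.eventually_norm_iteratedFDeriv_sub_le hΘ hθ₀ (m := 2) le_rfl hκ,
    hΘ.eventually_mem hθ₀] with θ hθ hmem z
  refine ContinuousLinearMap.opNorm_le_bound _ hκ.le fun y => ?_
  have h := (iteratedFDeriv ℝ 2 (v z) θ - iteratedFDeriv ℝ 2 (v z) θ₀).le_opNorm
    ![y, EuclideanSpace.single l 1]
  simp only [sub_apply, ← hv.fderiv_sens hΘ z l hmem,
    ← hv.fderiv_sens hΘ z l hθ₀, Fin.prod_univ_two] at h
  simp only [Matrix.cons_val_zero, Matrix.cons_val_one, PiLp.norm_single, norm_one,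
    mul_one] at h
  exact h.trans (mul_le_mul_of_nonneg_right (hθ z) (norm_nonneg _))

/-- Boundedness over `z` is not assumed; it follows from equicontinuity. Along a step of length `δ /
2` in direction `m` the sensitivity changes by at most 1, and by the Taylor expansion this change is
`δ / 2` times the second derivative up to an error `δ / 2`. -/
lemma SmoothInParam.exists_abs_sens_sens_le {Θ : Set (Param k)} (hΘ : IsOpen Θ)
    {v : Z → Param k → ℝ} (hv : SmoothInParam Θ v) {θ₀ : Param k} (hθ₀ : θ₀ ∈ Θ) :
    ∃ B, ∀ l m z, |sens (sens (v z) l) m θ₀| ≤ B := by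
  have hT : ∀ᶠ θ in 𝓝 θ₀, ∀ l z,
      |sens (v z) l θ - sens (v z) l θ₀ - ∑ m, (θ - θ₀) m * sens (sens (v z) l) m θ₀| ≤
        1 * ‖θ - θ₀‖ :=
    eventually_all.2 fun l => taylor_one_uniform hΘ hθ₀ (fun z => hv.differentiableOn_sens hΘ z l)
      (fun κ hκ => hv.eventually_norm_fderiv_sens_sub_le hΘ hθ₀ l hκ) one_pos
  obtain ⟨δ, hδ, hball⟩ := Metric.eventually_nhds_iff_ball.1
    (hT.and (hv.eventually_norm_fderiv_sub_le hΘ hθ₀ one_pos))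
  refine ⟨(1 + δ / 2) / (δ / 2), fun l m z => ?_⟩
  have hmem : θ₀ + EuclideanSpace.single m (δ / 2) ∈ Metric.ball θ₀ δ := by
    simp [abs_of_pos hδ, hδ]
  obtain ⟨h1, h2⟩ := hball _ hmem
  have h1 := h1 l z
  have h2 := (sens_sub_le (v z) l _ _).trans (h2 z)
  have hsum : ∑ m', (θ₀ + EuclideanSpace.single m (δ / 2) - θ₀) m' * sens (sens (v z) l) m' θ₀ =
      δ / 2 * sens (sens (v z) l) m θ₀ := by
    rw [Finset.sum_eq_single m] <;> simp +contextual
  rw [hsum] at h1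
  simp only [add_sub_cancel_left, PiLp.norm_single, Real.norm_eq_abs,
    abs_of_pos (half_pos hδ), one_mul] at h1
  rw [le_div_iff₀ (half_pos hδ), mul_comm, ← abs_of_pos (half_pos hδ), ← abs_mul,
    abs_of_pos (half_pos hδ)]
  rw [abs_le] at h1 h2 ⊢
  constructor <;> linarith [h1.1, h1.2, h2.1, h2.2]

lemma HasOrder.exists_abs_sub_le [MeasurableSpace Z] {μ : Measure Z} {p : ℝ} {Θ : Set (Param k)}
    {u : ℝ → Z → Param k → ℝ} {u₀ : Z → Param k → ℝ} (hu : HasOrder μ p Θ u u₀)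
    {K : Set (Param k)} (hK : K ⊆ Θ) (hKc : IsCompact K) :
    ∃ C h₀ : ℝ, 0 ≤ C ∧ 0 < h₀ ∧ ∀ h, 0 < h → h < h₀ → ∀ θ ∈ K, ∀ z,
      |u h z θ - u₀ z θ| ≤ C * h ^ p := by
  obtain ⟨w, C, h₀, hh₀, H⟩ := hu.2.1 K hK hKc
  -- `C` may be negative when there are no points or no parameters in `K`.
  refine ⟨|C|, h₀, abs_nonneg _, hh₀, fun h hh hh' θ hθ z => ?_⟩
  obtain ⟨h1, h2⟩ := H h hh hh' θ hθ z
  have hp := Real.rpow_nonneg hh.le p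
  rw [h1, add_sub_cancel_left, abs_mul, abs_of_nonneg hp, mul_comm]
  exact mul_le_mul_of_nonneg_right (h2.trans (le_abs_self C)) hp

end Calculus

/-! ### Deterministic least squares estimates -/

section Deterministic

variable {ι : Type*} [Fintype ι]

/-- The basic inequality of least squares: where the perturbed model fits the data at least as
well as the perturbed truth, the mean squared distance to the truth is small. -/
lemma sum_sq_le_of_cost_le {e a b g : ι → ℝ} {B s κ L n : ℝ} (hn : (Fintype.card ι : ℝ) = n)
    (hcost : ∑ i, (e i - (a i + b i)) ^ 2 ≤ ∑ i, (e i - g i) ^ 2)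
    (ha : ∀ i, |a i| ≤ B) (hb : ∀ i, |b i| ≤ s) (hg : ∀ i, |g i| ≤ s)
    (hea : |∑ i, a i * e i| ≤ κ * n) (he : ∑ i, |e i| ≤ L * n) (hs : 0 ≤ s) :
    ∑ i, a i ^ 2 ≤ (2 * B * s + 2 * κ + 4 * s * L + s ^ 2) * n := by
  -- Expand both squares: `e ^ 2` cancels, the term `a * e` is kept for the law of large numbers,
  -- and every other cross term contains a factor `b` or `g`, which is at most `s`.
  have hpt : ∀ i, a i ^ 2 ≤ ((e i - (a i + b i)) ^ 2 - (e i - g i) ^ 2) + 2 * (a i * e i) +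
      4 * s * |e i| + (s ^ 2 + 2 * B * s) := fun i => by
    have h1 : |a i * b i| ≤ B * s := by
      rw [abs_mul]
      exact mul_le_mul (ha i) (hb i) (abs_nonneg _) ((abs_nonneg _).trans (ha i))
    have h2 : |e i * b i| ≤ |e i| * s := by
      rw [abs_mul]; exact mul_le_mul_of_nonneg_left (hb i) (abs_nonneg _)
    have h3 : |e i * g i| ≤ |e i| * s := by
      rw [abs_mul]; exact mul_le_mul_of_nonneg_left (hg i) (abs_nonneg _)
    have h4 : g i ^ 2 ≤ s ^ 2 := sq_le_sq' (abs_le.1 (hg i)).1 (abs_le.1 (hg i)).2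
    rw [abs_le] at h1 h2 h3
    nlinarith [sq_nonneg (b i), h1.1, h2.1, h2.2, h3.1, h3.2]
  have hsum := Finset.sum_le_sum fun i (_ : i ∈ Finset.univ) => hpt i
  simp only [Finset.sum_add_distrib, Finset.sum_sub_distrib, ← Finset.mul_sum,
    Finset.sum_const, Finset.card_univ, nsmul_eq_mul, hn] at hsum
  have := mul_le_mul_of_nonneg_left he hs
  linarith [(abs_le.1 hea).2]

/-- Linearization of the normal equations `∑ (e - d) S = 0`. -/
lemma abs_sum_sub_sum_le_of_normal_equation {e d S m s A : ι → ℝ} {α β γ B L W n : ℝ}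
    (hn : (Fintype.card ι : ℝ) = n) (hfoc : ∑ i, (e i - d i) * S i = 0)
    (hS : ∀ i, |S i - s i - A i| ≤ α) (hS' : ∀ i, |S i - s i| ≤ β) (hd : ∀ i, |d i - m i| ≤ α)
    (hd' : ∀ i, |d i| ≤ γ) (hs : ∀ i, |s i| ≤ B) (he : ∑ i, |e i| ≤ L * n) (hα : 0 ≤ α)
    (hA : |∑ i, A i * e i| ≤ W) :
    |∑ i, m i * s i - ∑ i, s i * e i| ≤ W + (α * (L + B) + γ * β) * n := by
  -- Add the vanishing sum `hfoc` and regroup; each term of the second sum has a Taylor or numerical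
  -- error as a factor.
  have hid : ∑ i, m i * s i - ∑ i, s i * e i = ∑ i, A i * e i +
      ∑ i, (e i * (S i - s i - A i) - (d i - m i) * s i - d i * (S i - s i)) := by
    rw [← Finset.sum_sub_distrib, ← Finset.sum_add_distrib, ← add_zero (∑ i, (m i * s i - _)),
      ← hfoc, ← Finset.sum_add_distrib]
    exact Finset.sum_congr rfl fun i _ => by ring
  have hpt : ∀ i, |e i * (S i - s i - A i) - (d i - m i) * s i - d i * (S i - s i)| ≤
      α * |e i| + (α * B + γ * β) := fun i => by
    have h1 : |e i * (S i - s i - A i)| ≤ |e i| * α := by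
      rw [abs_mul]; exact mul_le_mul_of_nonneg_left (hS i) (abs_nonneg _)
    have h2 : |(d i - m i) * s i| ≤ α * B := by
      rw [abs_mul]; exact mul_le_mul (hd i) (hs i) (abs_nonneg _) hα
    have h3 : |d i * (S i - s i)| ≤ γ * β := by
      rw [abs_mul]
      exact mul_le_mul (hd' i) (hS' i) (abs_nonneg _) ((abs_nonneg _).trans (hd' i))
    rw [abs_le] at h1 h2 h3 ⊢
    constructor <;> linarith [h1.1, h1.2, h2.1, h2.2, h3.1, h3.2]
  have hsum := (Finset.abs_sum_le_sum_abs _ _).trans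
    (Finset.sum_le_sum fun i (_ : i ∈ Finset.univ) => hpt i)
  simp only [Finset.sum_add_distrib, ← Finset.mul_sum, Finset.sum_const, Finset.card_univ,
    nsmul_eq_mul, hn] at hsum
  rw [hid]
  have := mul_le_mul_of_nonneg_left he hα
  refine (abs_add_le _ _).trans ((add_le_add hA hsum).trans ?_)
  linarith

end Deterministic

/-! ### Local regularity of matrix inversion -/

section MatrixInverse

variable {k : ℕ}

lemma continuousAt_matrix_inv {A : Matrix (Fin k) (Fin k) ℝ} (hA : A.det ≠ 0) :
    ContinuousAt (fun B : Matrix (Fin k) (Fin k) ℝ => B⁻¹) A := by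
  simp only [Matrix.inv_def, Ring.inverse_eq_inv']
  exact ((continuous_id.matrix_det.continuousAt).inv₀ hA).smul
    continuous_id.matrix_adjugate.continuousAt

/-- Matrix inversion is Lipschitz near an invertible matrix. -/
lemma exists_nhds_abs_inv_sub_inv_le {G : Matrix (Fin k) (Fin k) ℝ} (hG : G.det ≠ 0) :
    ∃ C, 0 ≤ C ∧ ∃ U ∈ 𝓝 G, ∀ A ∈ U, A.det ≠ 0 ∧ ∀ B ∈ U,
      ∀ d, (∀ l m, |A l m - B l m| ≤ d) → ∀ l m, |A⁻¹ l m - B⁻¹ l m| ≤ C * d := by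
  obtain ⟨b, hb⟩ : ∃ b, ∀ l m, |G⁻¹ l m| < b := by
    refine ⟨∑ l, ∑ m, |G⁻¹ l m| + 1, fun l m => lt_add_of_le_of_pos ?_ one_pos⟩
    exact (Finset.single_le_sum (f := fun m => |G⁻¹ l m|) (fun _ _ => abs_nonneg _)
      (Finset.mem_univ m)).trans (Finset.single_le_sum (f := fun l => ∑ m, |G⁻¹ l m|)
      (fun _ _ => Finset.sum_nonneg fun _ _ => abs_nonneg _) (Finset.mem_univ l))
  have hdet : ∀ᶠ A in 𝓝 G, A.det ≠ 0 :=
    (continuous_id.matrix_det.continuousAt (x := G)).eventually_ne hG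
  have hbd : ∀ᶠ A in 𝓝 G, ∀ l m, |A⁻¹ l m| < b := by
    refine eventually_all.2 fun l => eventually_all.2 fun m => ?_
    have hc : Tendsto (fun A : Matrix (Fin k) (Fin k) ℝ => |A⁻¹ l m|) (𝓝 G) (𝓝 |G⁻¹ l m|) :=
      ((continuous_id.matrix_elem l m).abs.tendsto (G⁻¹)).comp
        (continuousAt_matrix_inv hG)
    exact hc.eventually_lt_const (hb l m)
  refine ⟨k * k * b ^ 2, by positivity, _, hdet.and hbd,
    fun A hA => ⟨hA.1, fun B hB d hd l m => ?_⟩⟩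
  -- Resolvent identity; on the neighbourhood the entries of both inverses are below `b`.
  have hid : A⁻¹ - B⁻¹ = A⁻¹ * (B - A) * B⁻¹ := by
    rw [mul_sub, sub_mul, mul_assoc, Matrix.mul_nonsing_inv _ (isUnit_iff_ne_zero.2 hB.1),
      Matrix.nonsing_inv_mul _ (isUnit_iff_ne_zero.2 hA.1), one_mul, mul_one]
  rw [← Matrix.sub_apply, hid, Matrix.mul_apply]
  simp only [Matrix.mul_apply, Finset.sum_mul]
  have hb0 : 0 ≤ b := (abs_nonneg _).trans (hb l m).le
  have hterm : ∀ i j, |A⁻¹ l i * (B - A) i j * B⁻¹ j m| ≤ b ^ 2 * d := fun i j => by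
    rw [abs_mul, abs_mul, Matrix.sub_apply, abs_sub_comm, pow_two, mul_assoc, mul_assoc,
      mul_comm b d]
    have hd0 := (abs_nonneg _).trans (hd i j)
    exact mul_le_mul (hA.2 l i).le (mul_le_mul (hd i j) (hB.2 j m).le (abs_nonneg _) hd0)
      (by positivity) hb0
  calc _ ≤ ∑ _j : Fin k, ∑ _i : Fin k, b ^ 2 * d :=
        (Finset.abs_sum_le_sum_abs _ _).trans (Finset.sum_le_sum fun j _ =>
          (Finset.abs_sum_le_sum_abs _ _).trans (Finset.sum_le_sum fun i _ => hterm i j))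
    _ = _ := by simp; ring

end MatrixInverse

/-! ### Algebra of Riemann integrable functions -/

section RiemannIntegrable

variable {Z : Type*} [TopologicalSpace Z] [MeasurableSpace Z] {μ : Measure Z} {v w : Z → ℝ}

lemma RiemannIntegrable.mul (hv : RiemannIntegrable v μ) (hw : RiemannIntegrable w μ) :
    RiemannIntegrable (fun z => v z * w z) μ := by
  obtain ⟨⟨B, hB⟩, hv⟩ := hv
  obtain ⟨⟨B', hB'⟩, hw⟩ := hw
  refine ⟨⟨B * B', fun z => ?_⟩, ?_⟩
  · rw [abs_mul]
    exact mul_le_mul (hB z) (hB' z) (abs_nonneg _) ((abs_nonneg _).trans (hB z))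
  · filter_upwards [hv, hw] with z h1 h2 using h1.mul h2

lemma RiemannIntegrable.sub (hv : RiemannIntegrable v μ) (hw : RiemannIntegrable w μ) :
    RiemannIntegrable (fun z => v z - w z) μ := by
  obtain ⟨⟨B, hB⟩, hv⟩ := hv
  obtain ⟨⟨B', hB'⟩, hw⟩ := hw
  refine ⟨⟨B + B', fun z => (abs_sub _ _).trans (add_le_add (hB z) (hB' z))⟩, ?_⟩
  filter_upwards [hv, hw] with z h1 h2 using h1.sub h2

end RiemannIntegrable

/-! ### Gram and covariance matrices of a design -/

section Gram

variable {T X : Type*} {k : ℕ} (t : ∀ M : ℕ, Fin M → T) (x : ∀ N : ℕ, Fin N → X)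

lemma gram_apply (v : T × X → Param k → ℝ) (θ : Param k) (M N : ℕ) (l m : Fin k) :
    gram t x v θ M N l m =
      ∑ r, sens (v (gridPt t x M N r)) l θ * sens (v (gridPt t x M N r)) m θ := by
  simp [gram, sensMatrix, Matrix.mul_apply]

lemma posSemidef_gram (v : T × X → Param k → ℝ) (θ : Param k) (M N : ℕ) :
    (gram t x v θ M N).PosSemidef := by
  rw [gram, ← Matrix.conjTranspose_eq_transpose_of_trivial]
  exact Matrix.posSemidef_conjTranspose_mul_self _

lemma posSemidef_covMat (v : T × X → Param k → ℝ) (θ : Param k) (M N : ℕ) :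
    (covMat t x v θ M N).PosSemidef :=
  (posSemidef_gram t x v θ M N).inv

/-- Holds for singular Gram matrices too, since then both inverses are zero by convention. -/
lemma smul_covMat (v : T × X → Param k → ℝ) (θ : Param k) {M N : ℕ} (hM : 0 < M) (hN : 0 < N) :
    ((M : ℝ) * N) • covMat t x v θ M N = (((M : ℝ) * N)⁻¹ • gram t x v θ M N)⁻¹ := by
  have h0 : ((M : ℝ) * N) ≠ 0 := by positivity
  by_cases hd : IsUnit (gram t x v θ M N).det
  · have := Matrix.inv_smul' (A := gram t x v θ M N) (Units.mk0 _ (inv_ne_zero h0)) hd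
    rw [covMat]
    rw [Units.smul_def, Units.val_mk0] at this
    rw [this, Units.smul_def, Units.val_inv_eq_inv_val, Units.val_mk0, inv_inv]
  · have hd' : ¬ IsUnit ((((M : ℝ) * N)⁻¹ • gram t x v θ M N).det) := by
      rw [Matrix.det_smul, isUnit_iff_ne_zero] at *
      simp_all
    rw [covMat, Matrix.nonsing_inv_apply_not_isUnit _ hd, Matrix.nonsing_inv_apply_not_isUnit _ hd',
      smul_zero]

lemma abs_gram_sub_gram_le {v w : T × X → Param k → ℝ} {θ : Param k} {B s : ℝ}
    (hw : ∀ l z, |sens (w z) l θ| ≤ B)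
    (hs : ∀ l z, |sens (v z) l θ - sens (w z) l θ| ≤ s) (M N : ℕ) (l m : Fin k) :
    |gram t x v θ M N l m - gram t x w θ M N l m| ≤ (2 * B * s + s ^ 2) * ((M : ℝ) * N) := by
  rw [gram_apply, gram_apply, ← Finset.sum_sub_distrib]
  -- From ab - a'b' = (a - a')(b - b') + (a - a')b' + a'(b - b').
  have hpt : ∀ a b a' b' : ℝ, |a'| ≤ B → |b'| ≤ B → |a - a'| ≤ s → |b - b'| ≤ s →
      |a * b - a' * b'| ≤ 2 * B * s + s ^ 2 := fun a b a' b' h1 h2 h3 h4 => by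
    have hB := (abs_nonneg _).trans h1
    have hs := (abs_nonneg _).trans h3
    have e1 : |(a - a') * (b - b')| ≤ s * s := by
      rw [abs_mul]; exact mul_le_mul h3 h4 (abs_nonneg _) hs
    have e2 : |(a - a') * b'| ≤ s * B := by
      rw [abs_mul]; exact mul_le_mul h3 h2 (abs_nonneg _) hs
    have e3 : |a' * (b - b')| ≤ B * s := by
      rw [abs_mul]; exact mul_le_mul h1 h4 (abs_nonneg _) hB
    rw [abs_le] at *
    constructor <;> nlinarith [e1.1, e1.2, e2.1, e2.2, e3.1, e3.2]
  refine (Finset.abs_sum_le_sum_abs _ _).trans ((Finset.sum_le_sum fun r _ =>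
    hpt _ _ _ _ (hw l _) (hw m _) (hs l _) (hs m _)).trans (le_of_eq ?_))
  simp only [Finset.sum_const, Finset.card_univ, Fintype.card_prod, Fintype.card_fin, nsmul_eq_mul]
  push_cast
  ring

lemma abs_smul_gram_sub_le {v w : T × X → Param k → ℝ} {θ : Param k} {M N : ℕ} (hM : 0 < M)
    (hN : 0 < N) {l m : Fin k} {d : ℝ}
    (h : |gram t x v θ M N l m - gram t x w θ M N l m| ≤ d * ((M : ℝ) * N)) :
    |(((M : ℝ) * N)⁻¹ • gram t x v θ M N) l m - (((M : ℝ) * N)⁻¹ • gram t x w θ M N) l m| ≤ d := by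
  have h0 : 0 < (M : ℝ) * N := by positivity
  rw [Matrix.smul_apply, Matrix.smul_apply, smul_eq_mul, smul_eq_mul, ← mul_sub, abs_mul,
    abs_of_pos (inv_pos.2 h0), inv_mul_le_iff₀ h0, mul_comm]
  exact h

lemma eventually_pos_design : ∀ᶠ MN : ℕ × ℕ in atTop ×ˢ atTop, 0 < MN.1 ∧ 0 < MN.2 :=
  (eventually_gt_atTop 0).prod_mk (eventually_gt_atTop 0)

lemma tendsto_rpow_nhdsGT {p : ℝ} (hp : 0 < p) :
    Tendsto (fun h : ℝ => h ^ p) (𝓝[>] 0) (𝓝 0) := by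
  have := (Real.continuousAt_rpow_const 0 p (Or.inr hp.le)).tendsto
  rw [Real.zero_rpow hp.ne'] at this
  exact this.mono_left nhdsWithin_le_nhds

/-! ### Numerical error of the Gram matrix -/

section Order

variable [MeasurableSpace T] [MeasurableSpace X] {ν : Measure T} {χ : Measure X}
  {Θ : Set (Param k)} {θ₀ : Param k} {u₀ : T × X → Param k → ℝ}
  {u : ℝ → T × X → Param k → ℝ} {p : ℝ}

lemma exists_abs_sens_sub_le {K : Set (Param k)} (hK : K ⊆ Θ) (hKc : IsCompact K)
    (hsensorder : ∀ l : Fin k, HasOrder (ν.prod χ) p Θ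
      (fun h z θ => sens (u h z) l θ) (fun z θ => sens (u₀ z) l θ)) :
    ∃ C h₀ : ℝ, 0 ≤ C ∧ 0 < h₀ ∧ ∀ h, 0 < h → h < h₀ → ∀ θ ∈ K, ∀ l z,
      |sens (u h z) l θ - sens (u₀ z) l θ| ≤ C * h ^ p := by
  choose C h₀ hC hh₀ H using fun l => (hsensorder l).exists_abs_sub_le hK hKc
  obtain ⟨d, hd, hd'⟩ : ∃ d > 0, ∀ l, d ≤ h₀ l := by
    rcases isEmpty_or_nonempty (Fin k) with _ | _
    · exact ⟨1, one_pos, fun l => isEmptyElim l⟩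
    · obtain ⟨l₀, hl₀⟩ := Finite.exists_min h₀
      exact ⟨h₀ l₀, hh₀ l₀, hl₀⟩
  refine ⟨∑ l, C l, d, Finset.sum_nonneg fun l _ => hC l, hd, fun h hh hhd θ hθ l z => ?_⟩
  refine (H l h hh (hhd.trans_le (hd' l)) θ hθ z).trans
    (mul_le_mul_of_nonneg_right ?_ (Real.rpow_nonneg hh.le p))
  exact Finset.single_le_sum (fun l _ => hC l) (Finset.mem_univ l)

lemma exists_abs_gram_sub_le (hθ₀ : θ₀ ∈ Θ) (hp : 0 < p) {B : ℝ}
    (hB : ∀ l z, |sens (u₀ z) l θ₀| ≤ B)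
    (hsensorder : ∀ l : Fin k, HasOrder (ν.prod χ) p Θ
      (fun h z θ => sens (u h z) l θ) (fun z θ => sens (u₀ z) l θ)) :
    ∃ C h₀ : ℝ, 0 ≤ C ∧ 0 < h₀ ∧ ∀ h, 0 < h → h < h₀ → ∀ (M N : ℕ) (l m : Fin k),
      |gram t x (u h) θ₀ M N l m - gram t x u₀ θ₀ M N l m| ≤ C * h ^ p * ((M : ℝ) * N) := by
  obtain ⟨C, h₀, hC, hh₀, H⟩ := exists_abs_sens_sub_le (Set.singleton_subset_iff.2 hθ₀)
    isCompact_singleton hsensorder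
  -- For `h ≤ 1` the quadratic error `(C * h ^ p) ^ 2` is at most `C ^ 2 * h ^ p`.
  refine ⟨2 * |B| * C + C ^ 2, min h₀ 1, by positivity, lt_min hh₀ one_pos,
    fun h hh hlt M N l m => ?_⟩
  have hp0 := Real.rpow_nonneg hh.le p
  have hp1 : h ^ p ≤ 1 := Real.rpow_le_one hh.le (hlt.le.trans (min_le_right _ _)) hp.le
  refine (abs_gram_sub_gram_le t x (fun l z => (hB l z).trans (le_abs_self B))
    (fun l z => H h hh (hlt.trans_le (min_le_left _ _)) θ₀ rfl l z) M N l m).trans ?_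
  refine mul_le_mul_of_nonneg_right ?_ (by positivity)
  nlinarith [mul_nonneg (sq_nonneg C) (mul_nonneg hp0 (sub_nonneg.2 hp1))]

end Order

/-! ### Convergence rate of the covariance matrices -/

section Rate

variable {θ₀ : Param k} {u₀ : T × X → Param k → ℝ} {u : ℝ → T × X → Param k → ℝ} {p : ℝ}

/-- For a fixed design, `V_h → V` at the rate `O(h ^ p)`. -/
lemma covMat_isBigO (hp : 0 < p) {C h₀ : ℝ} (hh₀ : 0 < h₀)
    (H : ∀ h, 0 < h → h < h₀ → ∀ (M N : ℕ) (l m : Fin k),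
      |gram t x (u h) θ₀ M N l m - gram t x u₀ θ₀ M N l m| ≤ C * h ^ p * ((M : ℝ) * N))
    {M N : ℕ} (hdet : (gram t x u₀ θ₀ M N).det ≠ 0) :
    (∀ᶠ h in 𝓝[>] (0 : ℝ), (gram t x (u h) θ₀ M N).det ≠ 0) ∧
      ∀ l m : Fin k,
        (fun h => covMat t x (u h) θ₀ M N l m - covMat t x u₀ θ₀ M N l m)
          =O[𝓝[>] (0 : ℝ)] fun h => h ^ p := by
  obtain ⟨C', hC', U, hU, HU⟩ := exists_nhds_abs_inv_sub_inv_le hdet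
  have hlt : ∀ᶠ h in 𝓝[>] (0 : ℝ), 0 < h ∧ h < h₀ := Ioo_mem_nhdsGT hh₀
  have hpow := tendsto_rpow_nhdsGT hp
  have hlim : Tendsto (fun h => gram t x (u h) θ₀ M N) (𝓝[>] 0) (𝓝 (gram t x u₀ θ₀ M N)) := by
    refine tendsto_pi_nhds.2 fun l => tendsto_pi_nhds.2 fun m => ?_
    rw [tendsto_iff_dist_tendsto_zero]
    refine squeeze_zero' (.of_forall fun _ => dist_nonneg) ?_
      (by simpa using (hpow.const_mul C).mul_const ((M : ℝ) * N))
    filter_upwards [hlt] with h hh using H h hh.1 hh.2 M N l m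
  have hmem := hlim.eventually hU
  refine ⟨hmem.mono fun h hh => (HU _ hh).1, fun l m => ?_⟩
  refine Asymptotics.IsBigO.of_bound (C' * (C * ((M : ℝ) * N))) ?_
  filter_upwards [hlt, hmem] with h hh hm
  rw [Real.norm_eq_abs, Real.norm_of_nonneg (Real.rpow_nonneg hh.1.le p)]
  refine ((HU _ hm).2 _ (mem_of_mem_nhds hU) _ (H h hh.1 hh.2 M N) l m).trans (le_of_eq ?_)
  ring

lemma tendsto_smul_gram_numerical {G : Matrix (Fin k) (Fin k) ℝ} (hp : 0 < p) {C h₀ : ℝ}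
    (hh₀ : 0 < h₀)
    (H : ∀ h, 0 < h → h < h₀ → ∀ (M N : ℕ) (l m : Fin k),
      |gram t x (u h) θ₀ M N l m - gram t x u₀ θ₀ M N l m| ≤ C * h ^ p * ((M : ℝ) * N))
    (hG : Tendsto (fun MN : ℕ × ℕ => ((MN.1 : ℝ) * MN.2)⁻¹ • gram t x u₀ θ₀ MN.1 MN.2)
      (atTop ×ˢ atTop) (𝓝 G)) :
    Tendsto (fun q : (ℕ × ℕ) × ℝ => ((q.1.1 : ℝ) * q.1.2)⁻¹ • gram t x (u q.2) θ₀ q.1.1 q.1.2)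
      ((atTop ×ˢ atTop) ×ˢ 𝓝[>] 0) (𝓝 G) := by
  refine tendsto_pi_nhds.2 fun l => tendsto_pi_nhds.2 fun m => ?_
  have h1 := ((continuous_id.matrix_elem l m).tendsto G).comp
    (hG.comp (tendsto_fst (g := 𝓝[>] (0 : ℝ))))
  have h2 : Tendsto (fun q : (ℕ × ℕ) × ℝ =>
      (((q.1.1 : ℝ) * q.1.2)⁻¹ • gram t x (u q.2) θ₀ q.1.1 q.1.2) l m -
        (((q.1.1 : ℝ) * q.1.2)⁻¹ • gram t x u₀ θ₀ q.1.1 q.1.2) l m)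
      ((atTop ×ˢ atTop) ×ˢ 𝓝[>] 0) (𝓝 0) := by
    refine squeeze_zero_norm' ?_
      (by simpa using ((tendsto_rpow_nhdsGT hp).const_mul C).comp tendsto_snd)
    filter_upwards [eventually_pos_design.prod_mk
      (show ∀ᶠ h in 𝓝[>] (0 : ℝ), 0 < h ∧ h < h₀ from Ioo_mem_nhdsGT hh₀)] with q hq
    exact abs_smul_gram_sub_le t x hq.1.1 hq.1.2 (H q.2 hq.2.1 hq.2.2 _ _ l m)
  simpa using h2.add h1

lemma posSemidef_of_tendsto {ι : Type*} {l : Filter ι} [l.NeBot]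
    {A : ι → Matrix (Fin k) (Fin k) ℝ} {G : Matrix (Fin k) (Fin k) ℝ}
    (hA : Tendsto A l (𝓝 G)) (hpos : ∀ i, (A i).PosSemidef) : G.PosSemidef := by
  refine Matrix.PosSemidef.of_dotProduct_mulVec_nonneg ?_ fun y => ?_
  · refine tendsto_nhds_unique
      ((continuous_id.matrix_conjTranspose.tendsto G).comp hA) (hA.congr fun i => ?_)
    exact ((hpos i).1).symm
  · have hc : Continuous fun B : Matrix (Fin k) (Fin k) ℝ => star y ⬝ᵥ B.mulVec y := by fun_prop
    exact ge_of_tendsto ((hc.tendsto G).comp hA)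
      (.of_forall fun i => (hpos i).dotProduct_mulVec_nonneg y)

/-- Uniformly over large designs, `MN V_h - MN V = O(h ^ p)`. -/
lemma exists_mul_abs_covMat_sub_le {G : Matrix (Fin k) (Fin k) ℝ} (hdet : G.det ≠ 0) {C h₀ : ℝ}
    (hh₀ : 0 < h₀)
    (H : ∀ h, 0 < h → h < h₀ → ∀ (M N : ℕ) (l m : Fin k),
      |gram t x (u h) θ₀ M N l m - gram t x u₀ θ₀ M N l m| ≤ C * h ^ p * ((M : ℝ) * N))
    (hG : Tendsto (fun MN : ℕ × ℕ => ((MN.1 : ℝ) * MN.2)⁻¹ • gram t x u₀ θ₀ MN.1 MN.2)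
      (atTop ×ˢ atTop) (𝓝 G))
    (hGh : Tendsto
      (fun q : (ℕ × ℕ) × ℝ => ((q.1.1 : ℝ) * q.1.2)⁻¹ • gram t x (u q.2) θ₀ q.1.1 q.1.2)
      ((atTop ×ˢ atTop) ×ˢ 𝓝[>] 0) (𝓝 G)) :
    ∃ C h₀ : ℝ, 0 < h₀ ∧ ∀ᶠ MN : ℕ × ℕ in atTop ×ˢ atTop,
      (gram t x u₀ θ₀ MN.1 MN.2).det ≠ 0 ∧
      ∀ h, 0 < h → h < h₀ →
        (gram t x (u h) θ₀ MN.1 MN.2).det ≠ 0 ∧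
        ∀ l m : Fin k,
          (MN.1 : ℝ) * MN.2 * |covMat t x (u h) θ₀ MN.1 MN.2 l m -
            covMat t x u₀ θ₀ MN.1 MN.2 l m| ≤ C * h ^ p := by
  obtain ⟨C', hC', U, hU, HU⟩ := exists_nhds_abs_inv_sub_inv_le hdet
  -- The joint limit is what provides a threshold for `h` independent of the design.
  obtain ⟨pa, hpa, pb, hpb, hab⟩ := eventually_prod_iff.1 (hGh.eventually hU)
  obtain ⟨h₁, hh₁, hIoo⟩ := (mem_nhdsGT_iff_exists_Ioo_subset).1 hpb
  refine ⟨C' * C, min h₀ h₁, lt_min hh₀ hh₁, ?_⟩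
  filter_upwards [hpa, hG.eventually hU, eventually_pos_design] with MN hMN hU₀ hpos
  have h0 : 0 < (MN.1 : ℝ) * MN.2 := by have := hpos.1; have := hpos.2; positivity
  have hne : ∀ A : Matrix (Fin k) (Fin k) ℝ, (((MN.1 : ℝ) * MN.2)⁻¹ • A).det ≠ 0 → A.det ≠ 0 :=
    fun A hA h => hA (by rw [Matrix.det_smul, h, mul_zero])
  refine ⟨hne _ (HU _ hU₀).1, fun h hh hlt => ?_⟩
  have hUh := hab hMN (hIoo ⟨hh, hlt.trans_le (min_le_right _ _)⟩)
  refine ⟨hne _ (HU _ hUh).1, fun l m => ?_⟩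
  have key := (HU _ hUh).2 _ hU₀ _ (fun l m => abs_smul_gram_sub_le t x hpos.1 hpos.2
    (H h hh (hlt.trans_le (min_le_left _ _)) _ _ l m)) l m
  rw [← smul_covMat t x _ _ hpos.1 hpos.2, ← smul_covMat t x _ _ hpos.1 hpos.2, Matrix.smul_apply,
    Matrix.smul_apply, smul_eq_mul, smul_eq_mul, ← mul_sub, abs_mul, abs_of_pos h0] at key
  rw [mul_assoc C']
  exact key

end Rate

/-! ### Limit of the normalized Gram matrix -/

section Limit

variable [TopologicalSpace T] [TopologicalSpace X] [MeasurableSpace T] [MeasurableSpace X]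
  {ν : Measure T} {χ : Measure X} {θ₀ : Param k} {u₀ : T × X → Param k → ℝ}

lemma tendsto_smul_gram (hA1 : DesignConverges t x ν χ)
    (hsensint : ∀ l : Fin k, RiemannIntegrable (fun z => sens (u₀ z) l θ₀) (ν.prod χ)) :
    Tendsto (fun MN : ℕ × ℕ => ((MN.1 : ℝ) * MN.2)⁻¹ • gram t x u₀ θ₀ MN.1 MN.2)
      (atTop ×ˢ atTop) (𝓝 (limitGram ν χ u₀ θ₀)) := by
  refine tendsto_pi_nhds.2 fun l => tendsto_pi_nhds.2 fun m => ?_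
  refine (hA1 _ ((hsensint l).mul (hsensint m))).congr fun MN => ?_
  rw [Matrix.smul_apply, gram_apply, Fintype.sum_prod_type, one_div, smul_eq_mul]

end Limit

end Gram

/-- The estimator minimizes the cost only almost surely, so events are compared up to null sets. No
measurability of the events is needed. -/
lemma measureReal_le_of_ae_imp {Ω : Type*} [MeasurableSpace Ω] {P : Measure Ω} [IsFiniteMeasure P]
    {s s' : Set Ω} (h : ∀ᵐ ω ∂P, ω ∈ s → ω ∈ s') : P.real s ≤ P.real s' :=
  ENNReal.toReal_mono (measure_ne_top _ _) (measure_mono_ae h)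

/-! ### Noise sums over the design -/

section DesignNoise

lemma iIndepFun_design {Ω : Type*} [MeasurableSpace Ω] {P : Measure Ω} {ε : ℕ → ℕ → Ω → ℝ}
    (hindep : iIndepFun (fun ij : ℕ × ℕ => ε ij.1 ij.2) P) (M N : ℕ) :
    iIndepFun (fun r : Fin M × Fin N => ε r.1 r.2) P :=
  hindep.precomp (g := fun r : Fin M × Fin N => ((r.1 : ℕ), (r.2 : ℕ))) fun r r' h => by
    simp only [Prod.mk.injEq] at h
    exact Prod.ext (Fin.ext h.1) (Fin.ext h.2)

variable {T X : Type*} (t : ∀ M : ℕ, Fin M → T) (x : ∀ N : ℕ, Fin N → X)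
  {Ω : Type*} [MeasurableSpace Ω] {P : Measure Ω} [IsProbabilityMeasure P]
  {η : ℝ≥0} {ε : ℕ → ℕ → Ω → ℝ}

lemma sum_sq_gridPt_le {a : T × X → ℝ} {B : ℝ} (ha : ∀ z, |a z| ≤ B) (M N : ℕ) :
    ∑ r, a (gridPt t x M N r) ^ 2 ≤ B ^ 2 * ((M : ℝ) * N) := by
  refine (Finset.sum_le_sum fun r _ => sq_le_sq' (abs_le.1 (ha _)).1 (abs_le.1 (ha _)).2).trans
    (le_of_eq ?_)
  simp [mul_comm]

/-- The mean absolute noise is bounded in probability. -/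
lemma exists_measureReal_sum_abs_noise_le (hlaw : ∀ i j, HasLaw (ε i j) (gaussianReal 0 (η ^ 2)) P)
    {ρ : ℝ} (hρ : 0 < ρ) :
    ∃ L, 0 < L ∧ ∀ M N : ℕ, 0 < M → 0 < N →
      P.real {ω | L * ((M : ℝ) * N) ≤ ∑ r : Fin M × Fin N, |ε r.1 r.2 ω|} ≤ ρ := by
  set c := ∫ x, |x| ∂gaussianReal 0 (η ^ 2)
  have hc : 0 ≤ c := integral_nonneg fun _ => abs_nonneg _
  -- Adding 1 keeps the bound positive when `η = 0`, where `c` vanishes.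
  refine ⟨(c + 1) / ρ, by positivity, fun M N hM hN => ?_⟩
  have h0 : 0 < (M : ℝ) * N := by positivity
  refine (measureReal_sum_abs_ge_le (e := fun r : Fin M × Fin N => ε r.1 r.2)
    (fun r => hlaw _ _) (by positivity)).trans ?_
  rw [Fintype.card_prod, Fintype.card_fin, Fintype.card_fin, div_le_iff₀ (by positivity)]
  push_cast
  have : ρ * ((c + 1) / ρ * (↑M * ↑N)) = (c + 1) * ((M : ℝ) * N) := by field_simp
  rw [this]
  nlinarith

/-- Normalized noise sums with uniformly bounded weights are bounded in probability. -/
lemma exists_measureReal_weighted_noise_le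
    (hlaw : ∀ i j, HasLaw (ε i j) (gaussianReal 0 (η ^ 2)) P)
    (hindep : iIndepFun (fun ij : ℕ × ℕ => ε ij.1 ij.2) P) (B : ℝ) {ρ : ℝ} (hρ : 0 < ρ) :
    ∃ L, 0 < L ∧ ∀ a : T × X → ℝ, (∀ z, |a z| ≤ B) → ∀ M N : ℕ, 0 < M → 0 < N →
      P.real {ω | L * √((M : ℝ) * N) ≤
        |∑ r : Fin M × Fin N, a (gridPt t x M N r) * ε r.1 r.2 ω|} ≤ ρ := by
  refine ⟨√((η ^ 2 * B ^ 2 + 1) / ρ), by positivity, fun a ha M N hM hN => ?_⟩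
  have h0 : 0 < (M : ℝ) * N := by positivity
  refine (measureReal_weightedSum_ge_le (e := fun r : Fin M × Fin N => ε r.1 r.2)
    (fun r => hlaw _ _) (iIndepFun_design hindep M N) (fun r => a (gridPt t x M N r))
    (by positivity)).trans ?_
  rw [mul_pow, Real.sq_sqrt (by positivity), Real.sq_sqrt h0.le, div_le_iff₀ (by positivity)]
  have h1 : ρ * ((η ^ 2 * B ^ 2 + 1) / ρ * (↑M * ↑N)) =
      ((η : ℝ) ^ 2 * B ^ 2 + 1) * ((M : ℝ) * N) := by field_simp
  have h2 := mul_le_mul_of_nonneg_left (sum_sq_gridPt_le t x ha M N) (sq_nonneg (η : ℝ))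
  rw [h1]
  nlinarith

/-- Weak law of large numbers for weighted noise. -/
lemma tendsto_measureReal_weighted_noise
    (hlaw : ∀ i j, HasLaw (ε i j) (gaussianReal 0 (η ^ 2)) P)
    (hindep : iIndepFun (fun ij : ℕ × ℕ => ε ij.1 ij.2) P) {a : T × X → ℝ} {B : ℝ}
    (ha : ∀ z, |a z| ≤ B) {κ : ℝ} (hκ : 0 < κ) :
    Tendsto (fun MN : ℕ × ℕ => P.real {ω | κ * ((MN.1 : ℝ) * MN.2) ≤
        |∑ r : Fin MN.1 × Fin MN.2, a (gridPt t x MN.1 MN.2 r) * ε r.1 r.2 ω|})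
      (atTop ×ˢ atTop) (𝓝 0) := by
  have hn : Tendsto (fun MN : ℕ × ℕ => (MN.1 : ℝ) * MN.2) (atTop ×ˢ atTop) atTop :=
    (tendsto_natCast_atTop_atTop.comp tendsto_fst).atTop_mul_atTop₀
      (tendsto_natCast_atTop_atTop.comp tendsto_snd)
  have hlim : Tendsto (fun MN : ℕ × ℕ => (η : ℝ) ^ 2 * B ^ 2 / κ ^ 2 * ((MN.1 : ℝ) * MN.2)⁻¹)
      (atTop ×ˢ atTop) (𝓝 0) := by
    simpa using hn.inv_tendsto_atTop.const_mul ((η : ℝ) ^ 2 * B ^ 2 / κ ^ 2)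
  refine squeeze_zero' (.of_forall fun _ => measureReal_nonneg) ?_ hlim
  filter_upwards [eventually_pos_design] with MN hpos
  have h0 : 0 < (MN.1 : ℝ) * MN.2 := by have := hpos.1; have := hpos.2; positivity
  refine (measureReal_weightedSum_ge_le (e := fun r : Fin MN.1 × Fin MN.2 => ε r.1 r.2)
    (fun r => hlaw _ _) (iIndepFun_design hindep _ _) (fun r => a (gridPt t x MN.1 MN.2 r))
    (by positivity)).trans ?_
  have h2 := mul_le_mul_of_nonneg_left (sum_sq_gridPt_le t x ha MN.1 MN.2) (sq_nonneg (η : ℝ))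
  rw [div_le_iff₀ (by positivity)]
  refine h2.trans (le_of_eq ?_)
  field_simp

end DesignNoise

/-! ### Cost comparison and normal equations -/

section LeastSquares

variable {T X : Type*} {k : ℕ} (t : ∀ M : ℕ, Fin M → T) (x : ∀ N : ℕ, Fin N → X)
  {Ω : Type*} {ε : ℕ → ℕ → Ω → ℝ}

lemma olsCost_data (v u₀ : T × X → Param k → ℝ) (θ₀ θ : Param k) (M N : ℕ) (ω : Ω) :
    olsCost t x v (data t x u₀ θ₀ ε M N ω) θ = (1 / ((M : ℝ) * N)) *
      ∑ r : Fin M × Fin N,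
        (ε r.1 r.2 ω - (v (gridPt t x M N r) θ - u₀ (gridPt t x M N r) θ₀)) ^ 2 := by
  rw [olsCost, Fintype.sum_prod_type]
  congr 1
  refine Finset.sum_congr rfl fun i _ => Finset.sum_congr rfl fun j _ => ?_
  simp only [data, Matrix.of_apply]
  ring

lemma IsOLS.sum_sq_le {v u₀ : T × X → Param k → ℝ} {θ₀ θ θ' : Param k} {M N : ℕ} {ω : Ω}
    {Θad : Set (Param k)} (h : IsOLS t x v Θad (data t x u₀ θ₀ ε M N ω) θ') (hθ : θ ∈ Θad)
    (hM : 0 < M) (hN : 0 < N) :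
    ∑ r : Fin M × Fin N,
        (ε r.1 r.2 ω - (v (gridPt t x M N r) θ' - u₀ (gridPt t x M N r) θ₀)) ^ 2 ≤
      ∑ r : Fin M × Fin N,
        (ε r.1 r.2 ω - (v (gridPt t x M N r) θ - u₀ (gridPt t x M N r) θ₀)) ^ 2 := by
  have h1 : olsCost t x v (data t x u₀ θ₀ ε M N ω) θ' ≤ olsCost t x v (data t x u₀ θ₀ ε M N ω) θ :=
    h.2 hθ
  rw [olsCost_data, olsCost_data] at h1
  exact le_of_mul_le_mul_left h1 (by positivity)

/-- The normal equations at an interior least squares estimate. -/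
lemma IsOLS.normal_equation {v u₀ : T × X → Param k → ℝ} {θ₀ θ' : Param k} {M N : ℕ} {ω : Ω}
    {Θad : Set (Param k)} (h : IsOLS t x v Θad (data t x u₀ θ₀ ε M N ω) θ')
    (hθ' : θ' ∈ interior Θad) (hv : ∀ z, DifferentiableAt ℝ (v z) θ')
    (hM : 0 < M) (hN : 0 < N) (l : Fin k) :
    ∑ r : Fin M × Fin N,
      (ε r.1 r.2 ω - (v (gridPt t x M N r) θ' - u₀ (gridPt t x M N r) θ₀)) *
        sens (v (gridPt t x M N r)) l θ' = 0 := by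
  let S : Param k → ℝ := fun θ => ∑ r : Fin M × Fin N,
    (ε r.1 r.2 ω - (v (gridPt t x M N r) θ - u₀ (gridPt t x M N r) θ₀)) ^ 2
  have hmin : IsLocalMin S θ' := by
    filter_upwards [mem_interior_iff_mem_nhds.1 hθ'] with θ hθ
    exact h.sum_sq_le t x hθ hM hN
  have hd : HasFDerivAt S (∑ r : Fin M × Fin N,
      (2 • (ε r.1 r.2 ω - (v (gridPt t x M N r) θ' - u₀ (gridPt t x M N r) θ₀)) ^ (2 - 1)) •
        (-fderiv ℝ (v (gridPt t x M N r)) θ')) θ' := by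
    refine HasFDerivAt.fun_sum fun r _ => ?_
    exact (((hv (gridPt t x M N r)).hasFDerivAt.sub_const _).const_sub _).pow 2
  have h0 := congrArg (fun A : Param k →L[ℝ] ℝ => A (EuclideanSpace.single l 1))
    (hmin.hasFDerivAt_eq_zero hd)
  have hsum : -2 * ∑ r : Fin M × Fin N,
      (ε r.1 r.2 ω - (v (gridPt t x M N r) θ' - u₀ (gridPt t x M N r) θ₀)) *
        sens (v (gridPt t x M N r)) l θ' = 0 := by
    refine Eq.trans ?_ h0
    rw [Finset.mul_sum]
    simp only [sum_apply, smul_apply, neg_apply, smul_eq_mul, nsmul_eq_mul]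
    refine Finset.sum_congr rfl fun r _ => ?_
    rw [sens]
    push_cast
    ring
  linarith

end LeastSquares

/-! ### Consistency -/

section Consistency

variable {T X : Type*} [TopologicalSpace T] [MeasurableSpace T] [TopologicalSpace X]
  [MeasurableSpace X] {ν : Measure T} {χ : Measure X} {k : ℕ}
  (t : ∀ M : ℕ, Fin M → T) (x : ∀ N : ℕ, Fin N → X)
  {Θ Θad : Set (Param k)} {θ₀ : Param k} {u₀ : T × X → Param k → ℝ}
  {u : ℝ → T × X → Param k → ℝ} {p : ℝ}
  {Ω : Type*} [MeasurableSpace Ω] {P : Measure Ω} [IsProbabilityMeasure P]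
  {η : ℝ≥0} {ε : ℕ → ℕ → Ω → ℝ} {θhat : ℕ → ℕ → ℝ → Ω → Param k}

/-- While the mean absolute noise is bounded, the estimator avoids, with high probability, a
neighbourhood of each wrong parameter. -/
lemma exists_nhds_tendsto_measureReal_estimator_mem (hΘ : IsOpen Θ) (hΘad : IsCompact Θad)
    (hadΘ : Θad ⊆ Θ) (hθ₀ : θ₀ ∈ Θad) (hsmooth : SmoothInParam Θ u₀)
    (hu₀int : ∀ θ ∈ Θ, RiemannIntegrable (fun z => u₀ z θ) (ν.prod χ))
    (horder : HasOrder (ν.prod χ) p Θ u u₀) (hA1 : DesignConverges t x ν χ)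
    (hlaw : ∀ i j, HasLaw (ε i j) (gaussianReal 0 (η ^ 2)) P)
    (hindep : iIndepFun (fun ij : ℕ × ℕ => ε ij.1 ij.2) P)
    (hθhat : ∀ᶠ h in 𝓝[>] (0 : ℝ), ∀ M N,
      ∀ᵐ ω ∂P, IsOLS t x (u h) Θad (data t x u₀ θ₀ ε M N ω) (θhat M N h ω))
    {θ : Param k} (hθ : θ ∈ Θad) (hcost : 0 < limitCost ν χ u₀ θ₀ θ) {L : ℝ} (hL : 0 < L) :
    ∃ U ∈ 𝓝 θ, Tendsto (fun q : (ℕ × ℕ) × ℝ => P.real {ω | θhat q.1.1 q.1.2 q.2 ω ∈ U ∧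
        ∑ r : Fin q.1.1 × Fin q.1.2, |ε r.1 r.2 ω| < L * ((q.1.1 : ℝ) * q.1.2)})
      ((atTop ×ˢ atTop) ×ˢ 𝓝[>] 0) (𝓝 0) := by
  set c := limitCost ν χ u₀ θ₀ θ with hc
  set a : T × X → ℝ := fun z => u₀ z θ - u₀ z θ₀ with ha
  have haint : RiemannIntegrable a (ν.prod χ) :=
    (hu₀int θ (hadΘ hθ)).sub (hu₀int θ₀ (hadΘ hθ₀))
  obtain ⟨B, hB⟩ := haint.1
  -- With `s = 2 * κ` and `κ ≤ 1`, the constant in `sum_sq_le_of_cost_le` is at most `κ * K`. The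
  -- choice of `κ` makes this at most `c / 2`, half the limiting mean square.
  set K := 4 * |B| + 8 * L + 6 with hK
  have hKpos : 0 < K := by positivity
  set κ := min 1 (c / (2 * K)) with hκdef
  have hκ : 0 < κ := lt_min one_pos (by positivity)
  have hκ1 : κ ≤ 1 := min_le_left _ _
  have hκc : κ * K ≤ c / 2 := by
    have h := mul_le_mul_of_nonneg_right (min_le_right 1 (c / (2 * K))) hKpos.le
    refine h.trans (le_of_eq ?_)
    field_simp
  obtain ⟨C, h₀, hC, hh₀, H⟩ := horder.exists_abs_sub_le hadΘ hΘad
  -- On this neighbourhood the model is frozen at `θ`, so the law of large numbers is needed for the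
  -- single weight `a` and not uniformly in the parameter; the drift is paid for by the mean
  -- absolute noise, below `L`.
  refine ⟨{θ' | ∀ z, |u₀ z θ' - u₀ z θ| ≤ κ}, hsmooth.eventually_abs_sub_le hΘ (hadΘ hθ) hκ, ?_⟩
  have hsq : Tendsto (fun MN : ℕ × ℕ =>
      (1 / ((MN.1 : ℝ) * MN.2)) * ∑ r, a (gridPt t x MN.1 MN.2 r) ^ 2)
      (atTop ×ˢ atTop) (𝓝 c) := by
    have h1 := hA1 _ (haint.mul haint)
    have h2 : ∫ z, a z * a z ∂(ν.prod χ) = c := by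
      rw [hc, limitCost]
      congr with z
      simp only [ha]
      ring
    rw [h2] at h1
    refine h1.congr fun MN => ?_
    rw [Fintype.sum_prod_type]
    simp only [pow_two]
  have hlln := (tendsto_measureReal_weighted_noise t x hlaw hindep hB hκ).comp
    (tendsto_fst (g := 𝓝[>] (0 : ℝ)))
  refine squeeze_zero' (.of_forall fun _ => measureReal_nonneg) ?_ hlln
  have hpow : ∀ᶠ h in 𝓝[>] (0 : ℝ), C * h ^ p < κ := by
    have := (tendsto_rpow_nhdsGT horder.1).const_mul C
    rw [mul_zero] at this
    exact this.eventually_lt_const hκ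
  filter_upwards [(eventually_pos_design.and (hsq.eventually_const_lt (half_lt_self hcost))).prod_mk
    ((show ∀ᶠ h in 𝓝[>] (0 : ℝ), 0 < h ∧ h < h₀ from Ioo_mem_nhdsGT hh₀).and
      (hpow.and hθhat))] with q hq
  obtain ⟨⟨⟨hM, hN⟩, hsum⟩, ⟨hh, hlt⟩, hsmall, hols⟩ := hq
  have h0 : 0 < (q.1.1 : ℝ) * q.1.2 := by positivity
  refine measureReal_le_of_ae_imp ?_
  filter_upwards [hols q.1.1 q.1.2] with ω hω hmem
  obtain ⟨hU, habs⟩ := hmem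
  by_contra hlt'
  simp only [not_le] at hlt'
  have hnum := H q.2 hh hlt
  -- The competitor is `θ₀`. The perturbation `b` collects parameter drift and numerical error, each
  -- at most `κ`; `g` is the numerical error at the truth.
  have hbound := sum_sq_le_of_cost_le (ι := Fin q.1.1 × Fin q.1.2)
    (e := fun r => ε r.1 r.2 ω) (a := fun r => a (gridPt t x q.1.1 q.1.2 r))
    (b := fun r => u q.2 (gridPt t x q.1.1 q.1.2 r) (θhat q.1.1 q.1.2 q.2 ω) -
      u₀ (gridPt t x q.1.1 q.1.2 r) θ)
    (g := fun r => u q.2 (gridPt t x q.1.1 q.1.2 r) θ₀ - u₀ (gridPt t x q.1.1 q.1.2 r) θ₀)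
    (B := |B|) (s := 2 * κ) (κ := κ) (L := L) (n := (q.1.1 : ℝ) * q.1.2) (by simp)
    (by
      refine le_trans (le_of_eq ?_) (hω.sum_sq_le t x hθ₀ hM hN)
      refine Finset.sum_congr rfl fun r _ => ?_
      simp only [ha]
      ring)
    (fun r => (hB _).trans (le_abs_self B))
    (fun r => by
      have h1 := hnum _ hω.1 (gridPt t x q.1.1 q.1.2 r)
      have h2 := hU (gridPt t x q.1.1 q.1.2 r)
      rw [abs_le] at *
      constructor <;> linarith [h1.1, h1.2, h2.1, h2.2])
    (fun r => ((hnum _ hθ₀ _).trans hsmall.le).trans (by linarith))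
    hlt'.le habs.le (by positivity)
  have h1 : c / 2 * ((q.1.1 : ℝ) * q.1.2) < ∑ r, a (gridPt t x q.1.1 q.1.2 r) ^ 2 := by
    rwa [one_div, lt_inv_mul_iff₀ h0, mul_comm] at hsum
  have h2 : 2 * |B| * (2 * κ) + 2 * κ + 4 * (2 * κ) * L + (2 * κ) ^ 2 ≤ c / 2 := by
    refine le_trans ?_ hκc
    rw [hK]
    nlinarith
  exact absurd (h1.trans_le (hbound.trans (mul_le_mul_of_nonneg_right h2 h0.le))) (lt_irrefl _)

/-- Consistency of the least squares estimator, jointly in the design and in the step size. -/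
lemma tendsto_measureReal_estimator_sub (hΘ : IsOpen Θ) (hΘad : IsCompact Θad)
    (hadΘ : Θad ⊆ Θ) (hθ₀ : θ₀ ∈ Θad) (hsmooth : SmoothInParam Θ u₀)
    (hu₀int : ∀ θ ∈ Θ, RiemannIntegrable (fun z => u₀ z θ) (ν.prod χ))
    (horder : HasOrder (ν.prod χ) p Θ u u₀) (hA1 : DesignConverges t x ν χ)
    (hA2 : ∀ θ ∈ Θad, θ ≠ θ₀ → limitCost ν χ u₀ θ₀ θ₀ < limitCost ν χ u₀ θ₀ θ)
    (hlaw : ∀ i j, HasLaw (ε i j) (gaussianReal 0 (η ^ 2)) P)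
    (hindep : iIndepFun (fun ij : ℕ × ℕ => ε ij.1 ij.2) P)
    (hθhat : ∀ᶠ h in 𝓝[>] (0 : ℝ), ∀ M N,
      ∀ᵐ ω ∂P, IsOLS t x (u h) Θad (data t x u₀ θ₀ ε M N ω) (θhat M N h ω))
    {γ : ℝ} (hγ : 0 < γ) :
    Tendsto (fun q : (ℕ × ℕ) × ℝ => P.real {ω | γ ≤ ‖θhat q.1.1 q.1.2 q.2 ω - θ₀‖})
      ((atTop ×ˢ atTop) ×ˢ 𝓝[>] 0) (𝓝 0) := by
  refine Metric.tendsto_nhds.2 fun ρ hρ => ?_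
  obtain ⟨L, hL, htight⟩ := exists_measureReal_sum_abs_noise_le hlaw (half_pos hρ)
  have hcompact : Tendsto (fun q : (ℕ × ℕ) × ℝ =>
      P.real {ω | θhat q.1.1 q.1.2 q.2 ω ∈ Θad \ Metric.ball θ₀ γ ∧
        ∑ r : Fin q.1.1 × Fin q.1.2, |ε r.1 r.2 ω| < L * ((q.1.1 : ℝ) * q.1.2)})
      ((atTop ×ˢ atTop) ×ˢ 𝓝[>] 0) (𝓝 0) := by
    -- The property passes to subsets and finite unions, so holding near each point of the compact
    -- set it holds on all of it.
    refine (hΘad.diff Metric.isOpen_ball).induction_on (p := fun s : Set (Param k) =>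
      Tendsto (fun q : (ℕ × ℕ) × ℝ =>
        P.real {ω | θhat q.1.1 q.1.2 q.2 ω ∈ s ∧
          ∑ r : Fin q.1.1 × Fin q.1.2, |ε r.1 r.2 ω| < L * ((q.1.1 : ℝ) * q.1.2)})
        ((atTop ×ˢ atTop) ×ˢ 𝓝[>] 0) (𝓝 0)) ?_ ?_ ?_ ?_
    · simp
    · exact fun s s' hss' hs' => squeeze_zero (fun _ => measureReal_nonneg)
        (fun q => measureReal_mono (by rintro ω ⟨h1, h2⟩; exact ⟨hss' h1, h2⟩)) hs'
    · intro s s' hs hs'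
      refine squeeze_zero (fun _ => measureReal_nonneg) (fun q => ?_) (by simpa using hs.add hs')
      refine (measureReal_mono ?_).trans (measureReal_union_le _ _)
      rintro ω ⟨h1 | h1, h2⟩
      exacts [Or.inl ⟨h1, h2⟩, Or.inr ⟨h1, h2⟩]
    · intro θ hθ
      have hne : θ ≠ θ₀ := by
        rintro rfl
        exact hθ.2 (Metric.mem_ball_self hγ)
      have hpos := hA2 θ hθ.1 hne
      rw [show limitCost ν χ u₀ θ₀ θ₀ = 0 by simp [limitCost]] at hpos
      obtain ⟨U, hU, h⟩ := exists_nhds_tendsto_measureReal_estimator_mem t x hΘ hΘad hadΘ hθ₀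
        hsmooth hu₀int horder hA1 hlaw hindep hθhat hθ.1 hpos hL
      exact ⟨U, mem_nhdsWithin_of_mem_nhds hU, h⟩
  filter_upwards [hcompact.eventually_lt_const (half_pos hρ),
    eventually_pos_design.prod_mk hθhat] with q hq hq'
  rw [Real.dist_0_eq_abs, abs_of_nonneg measureReal_nonneg]
  have h1 : P.real {ω | γ ≤ ‖θhat q.1.1 q.1.2 q.2 ω - θ₀‖} ≤
      P.real ({ω | L * ((q.1.1 : ℝ) * q.1.2) ≤ ∑ r : Fin q.1.1 × Fin q.1.2, |ε r.1 r.2 ω|} ∪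
        {ω | θhat q.1.1 q.1.2 q.2 ω ∈ Θad \ Metric.ball θ₀ γ ∧
        ∑ r : Fin q.1.1 × Fin q.1.2, |ε r.1 r.2 ω| < L * ((q.1.1 : ℝ) * q.1.2)}) := by
    refine measureReal_le_of_ae_imp ?_
    filter_upwards [hq'.2 q.1.1 q.1.2] with ω hω hdist
    rcases le_or_gt (L * ((q.1.1 : ℝ) * q.1.2)) (∑ r : Fin q.1.1 × Fin q.1.2, |ε r.1 r.2 ω|)
      with h | h
    · exact Or.inl h
    · refine Or.inr ⟨⟨hω.1, ?_⟩, h⟩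
      rw [Metric.mem_ball, dist_eq_norm, not_lt]
      exact hdist
  linarith [h1.trans (measureReal_union_le _ _), htight q.1.1 q.1.2 hq'.1.1 hq'.1.2]

end Consistency

/-! ### Linearized normal equations and their solution -/

section Linearization

variable {ι : Type*} [Fintype ι] {k : ℕ}

lemma abs_sum_coord_mul_le (v : Param k) {a : Fin k → ℝ} {B : ℝ} (ha : ∀ m, |a m| ≤ B) :
    |∑ m, v m * a m| ≤ k * B * ‖v‖ := by
  refine (Finset.abs_sum_le_sum_abs _ _).trans ((Finset.sum_le_sum (g := fun _ => ‖v‖ * B)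
    fun m _ => ?_).trans (le_of_eq ?_))
  · rw [abs_mul]
    exact mul_le_mul (abs_coord_le_norm v m) (ha m) (abs_nonneg _) (norm_nonneg _)
  · simp; ring

/-- The normal equations, linearized at the true parameter and normalized. -/
lemma abs_sqrt_smul_mulVec_sub_le {e d : ι → ℝ} {S s : ι → Fin k → ℝ} {a : ι → Fin k → Fin k → ℝ}
    {G : Matrix (Fin k) (Fin k) ℝ} {Δ : Param k} {n κ τ B L : ℝ}
    (hn : (Fintype.card ι : ℝ) = n) (hn0 : 0 < n) (hfoc : ∀ l, ∑ i, (e i - d i) * S i l = 0)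
    (hd : ∀ i, |d i - ∑ m, Δ m * s i m| ≤ κ * ‖Δ‖ + τ)
    (hS : ∀ i l, |S i l - s i l - ∑ m, Δ m * a i l m| ≤ κ * ‖Δ‖ + τ)
    (hS' : ∀ i l, |S i l - s i l| ≤ κ + τ) (hs : ∀ i l, |s i l| ≤ B)
    (he : ∑ i, |e i| ≤ L * n) (hae : ∀ l m, |∑ i, a i l m * e i| ≤ L * √n)
    (hG : ∀ l m, |n⁻¹ * (∑ i, s i l * s i m) - G l m| ≤ κ) (hκ : 0 ≤ κ) (hκ1 : κ ≤ 1)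
    (hΔ : ‖Δ‖ ≤ κ) (hτ : 0 ≤ τ) (hτκ : τ ≤ κ) (hnτ : √n * τ ≤ κ) (hL : 0 ≤ L) (hB : 0 ≤ B)
    (l : Fin k) :
    |√n * (G.mulVec Δ) l - (√n)⁻¹ * ∑ i, s i l * e i| ≤
      κ * (k + k * L + L + B + 2 * k * B + 2) * (√n * ‖Δ‖ + 1) := by
  have hr : 0 < √n := Real.sqrt_pos.2 hn0
  have hrr : √n * √n = n := Real.mul_self_sqrt hn0.le
  have hD := norm_nonneg Δ
  have hA : |∑ i, (∑ m, Δ m * a i l m) * e i| ≤ k * (L * √n) * ‖Δ‖ := by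
    have : ∑ i, (∑ m, Δ m * a i l m) * e i = ∑ m, Δ m * ∑ i, a i l m * e i := by
      simp only [Finset.sum_mul, Finset.mul_sum]
      rw [Finset.sum_comm]
      exact Finset.sum_congr rfl fun _ _ => Finset.sum_congr rfl fun _ _ => by ring
    rw [this]
    exact abs_sum_coord_mul_le Δ (hae l)
  have hd' : ∀ i, |d i| ≤ k * B * ‖Δ‖ + (κ * ‖Δ‖ + τ) := fun i => by
    have h1 := abs_sum_coord_mul_le Δ (hs i)
    have h2 := hd i
    rw [abs_le] at *
    constructor <;> linarith [h1.1, h1.2, h2.1, h2.2]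
  have hlin := abs_sum_sub_sum_le_of_normal_equation hn (hfoc l) (fun i => hS i l)
    (fun i => hS' i l) hd hd' (fun i => hs i l) he (by positivity) hA
  have hGm : |∑ m, Δ m * (n⁻¹ * (∑ i, s i l * s i m) - G l m)| ≤ k * κ * ‖Δ‖ :=
    abs_sum_coord_mul_le Δ (hG l)
  -- Splits the defect into the linearization error and the error of replacing the normalized Gram
  -- matrix by its limit `G`.
  have hid : √n * (G.mulVec Δ) l - (√n)⁻¹ * ∑ i, s i l * e i =
      (√n)⁻¹ * (∑ i, (∑ m, Δ m * s i m) * s i l - ∑ i, s i l * e i) -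
        √n * ∑ m, Δ m * (n⁻¹ * (∑ i, s i l * s i m) - G l m) := by
    have h1 : ∑ i, (∑ m, Δ m * s i m) * s i l = ∑ m, Δ m * ∑ i, s i l * s i m := by
      simp only [Finset.sum_mul, Finset.mul_sum]
      rw [Finset.sum_comm]
      exact Finset.sum_congr rfl fun _ _ => Finset.sum_congr rfl fun _ _ => by ring
    have h2 : ∑ m, Δ m * (n⁻¹ * (∑ i, s i l * s i m) - G l m) =
        n⁻¹ * (∑ m, Δ m * ∑ i, s i l * s i m) - (G.mulVec Δ) l := by
      simp only [mul_sub, Finset.sum_sub_distrib, Matrix.mulVec, dotProduct]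
      congr 1
      · rw [Finset.mul_sum]
        exact Finset.sum_congr rfl fun _ _ => by ring
      · exact Finset.sum_congr rfl fun _ _ => by ring
    have h3 : (√n)⁻¹ = √n * n⁻¹ := by
      rw [← div_eq_mul_inv, Real.sqrt_div_self]
    rw [h1, h2, h3]
    ring
  set V := √n * ‖Δ‖ with hV
  have hV0 : 0 ≤ V := by positivity
  have hstep1 : |(√n)⁻¹ * (∑ i, (∑ m, Δ m * s i m) * s i l - ∑ i, s i l * e i)| ≤
      k * L * ‖Δ‖ + ((κ * V + √n * τ) * (L + B) +
        (k * B * V + (κ * V + √n * τ)) * (κ + τ)) := by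
    rw [abs_mul, abs_of_pos (inv_pos.2 hr), inv_mul_le_iff₀ hr]
    refine hlin.trans (le_of_eq ?_)
    rw [hV]
    nth_rewrite 2 [← hrr]
    ring
  have hstep2 : |√n * ∑ m, Δ m * (n⁻¹ * (∑ i, s i l * s i m) - G l m)| ≤ k * κ * V := by
    rw [abs_mul, abs_of_pos hr, hV]
    refine (mul_le_mul_of_nonneg_left hGm hr.le).trans (le_of_eq (by ring))
  rw [hid]
  refine (abs_sub _ _).trans ((add_le_add hstep1 hstep2).trans ?_)
  -- The noise weighted by second derivatives is O(√n), so after division by √n it enters only with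
  -- the small factor `‖Δ‖`.
  have b1 : k * L * ‖Δ‖ ≤ k * L * κ := mul_le_mul_of_nonneg_left hΔ (by positivity)
  have b2 : (κ * V + √n * τ) * (L + B) ≤ (κ * V + κ) * (L + B) :=
    mul_le_mul_of_nonneg_right (by linarith) (by positivity)
  have hκV : κ * V ≤ V := by nlinarith
  have b3 : (k * B * V + (κ * V + √n * τ)) * (κ + τ) ≤ (k * B * V + (V + 1)) * (κ + κ) :=
    mul_le_mul (by linarith) (by linarith) (by positivity) (by positivity)
  have hk : (0 : ℝ) ≤ k := Nat.cast_nonneg k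
  -- Exactly the slack between the sum of the preceding bounds and the claim.
  have b4 : 0 ≤ κ * (k * L * V + k + 2 * k * B) := by positivity
  nlinarith

lemma exists_norm_mulVec_le (A : Matrix (Fin k) (Fin k) ℝ) :
    ∃ c, 0 ≤ c ∧ ∀ (y : Fin k → ℝ) (b : ℝ), 0 ≤ b → (∀ l, |y l| ≤ b) →
      ‖(WithLp.toLp 2 (A.mulVec y) : Param k)‖ ≤ c * b := by
  let F : (Fin k → ℝ) →L[ℝ] Param k :=
    LinearMap.toContinuousLinearMap
      ((WithLp.linearEquiv 2 ℝ (Fin k → ℝ)).symm.toLinearMap ∘ₗ A.mulVecLin)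
  refine ⟨‖F‖, norm_nonneg _, fun y b hb hy => (F.le_opNorm y).trans ?_⟩
  exact mul_le_mul_of_nonneg_left ((pi_norm_le_iff_of_nonneg hb).2 hy) (norm_nonneg _)

/-- Solving the linearized normal equations. -/
lemma norm_sub_inv_mulVec_le {G : Matrix (Fin k) (Fin k) ℝ} (hG : G.det ≠ 0) {c : ℝ} (hc : 0 ≤ c)
    (hcb : ∀ (y : Fin k → ℝ) (b : ℝ), 0 ≤ b → (∀ l, |y l| ≤ b) →
      ‖(WithLp.toLp 2 (G⁻¹.mulVec y) : Param k)‖ ≤ c * b)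
    {v : Param k} {ξ : Fin k → ℝ} {b L : ℝ} (hb : 0 ≤ b) (hL : 0 ≤ L)
    (hv : ∀ l, |G.mulVec v l - ξ l| ≤ b * (‖v‖ + 1)) (hξ : ∀ l, |ξ l| ≤ L) (hcb' : c * b ≤ 1 / 2) :
    ‖v - (WithLp.toLp 2 (G⁻¹.mulVec ξ) : Param k)‖ ≤ c * b * (2 + 2 * c * L) := by
  have hinv : ∀ w : Param k, (WithLp.toLp 2 (G⁻¹.mulVec (G.mulVec w)) : Param k) = w := fun w => by
    rw [Matrix.mulVec_mulVec, Matrix.nonsing_inv_mul _ (isUnit_iff_ne_zero.2 hG),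
      Matrix.one_mulVec]
  have h0 : 0 ≤ b * (‖v‖ + 1) := by positivity
  -- The hypothesis bounds the residual in terms of `v` itself; since `c * b ≤ 1 / 2`, the term in
  -- `‖v‖` is absorbed on the left, which gives `h3`.
  have h1 : ‖v‖ ≤ c * (b * (‖v‖ + 1) + L) := by
    conv_lhs => rw [← hinv v]
    refine hcb _ _ (by positivity) fun l => ?_
    have := hv l
    have := hξ l
    rw [abs_le] at *
    constructor <;> linarith
  have h2 : ‖v - (WithLp.toLp 2 (G⁻¹.mulVec ξ) : Param k)‖ ≤ c * (b * (‖v‖ + 1)) := by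
    conv_lhs => rw [← hinv v, ← WithLp.toLp_sub, ← Matrix.mulVec_sub]
    exact hcb _ _ h0 hv
  have h3 : ‖v‖ ≤ 1 + 2 * c * L := by nlinarith [norm_nonneg v]
  refine h2.trans ?_
  rw [← mul_assoc]
  exact mul_le_mul_of_nonneg_left (by linarith) (by positivity)

end Linearization

/-! ### The Gaussian leading term -/

section LeadingTerm

variable {T X : Type*} {k : ℕ} (t : ∀ M : ℕ, Fin M → T) (x : ∀ N : ℕ, Fin N → X)
  {Ω : Type*}

/-- The Gaussian leading term `G⁻¹ (MN)^(-1/2) ∑ ε ∇u₀(θ₀)` of the normalized estimation error. -/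
noncomputable def leadingTerm (G : Matrix (Fin k) (Fin k) ℝ) (u₀ : T × X → Param k → ℝ)
    (θ₀ : Param k) (ε : ℕ → ℕ → Ω → ℝ) (M N : ℕ) (ω : Ω) : Param k :=
  ∑ r : Fin M × Fin N, ε r.1 r.2 ω • WithLp.toLp 2
    ((√((M : ℝ) * N))⁻¹ • G⁻¹.mulVec (sensMatrix t x u₀ θ₀ M N r))

variable {G : Matrix (Fin k) (Fin k) ℝ} {u₀ : T × X → Param k → ℝ} {θ₀ : Param k}
    {ε : ℕ → ℕ → Ω → ℝ}

lemma leadingTerm_eq (M N : ℕ) (ω : Ω) :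
    leadingTerm t x G u₀ θ₀ ε M N ω = WithLp.toLp 2 (G⁻¹.mulVec fun l =>
      (√((M : ℝ) * N))⁻¹ * ∑ r : Fin M × Fin N,
        sens (u₀ (gridPt t x M N r)) l θ₀ * ε r.1 r.2 ω) := by
  ext m
  simp only [leadingTerm, WithLp.ofLp_sum, WithLp.ofLp_smul, Finset.sum_apply, Pi.smul_apply,
    smul_eq_mul, Matrix.mulVec, dotProduct, sensMatrix, Matrix.of_apply, Finset.mul_sum]
  rw [Finset.sum_comm]
  exact Finset.sum_congr rfl fun _ _ => Finset.sum_congr rfl fun _ _ => by ring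

variable [MeasurableSpace Ω] {P : Measure Ω} {η : ℝ≥0}

lemma aemeasurable_leadingTerm (hlaw : ∀ i j, HasLaw (ε i j) (gaussianReal 0 (η ^ 2)) P)
    (M N : ℕ) : AEMeasurable (leadingTerm t x G u₀ θ₀ ε M N) P :=
  Finset.aemeasurable_fun_sum _ fun r _ => (hlaw r.1 r.2).aemeasurable.smul_const _

variable [IsProbabilityMeasure P]

/-- With g = G⁻ᵀ s, the projection on `s` has weights n^(-1/2) (∇U₀ g)_r, whose squares sum to the
quadratic form of the normalized Gram matrix at g. -/
lemma charFun_leadingTerm (hlaw : ∀ i j, HasLaw (ε i j) (gaussianReal 0 (η ^ 2)) P)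
    (hindep : iIndepFun (fun ij : ℕ × ℕ => ε ij.1 ij.2) P) (M N : ℕ) (s : Param k) :
    charFun (P.map (leadingTerm t x G u₀ θ₀ ε M N)) s =
      Complex.exp (-(((η : ℝ) ^ 2 * (Matrix.vecMul s G⁻¹ ⬝ᵥ
        (((M : ℝ) * N)⁻¹ • gram t x u₀ θ₀ M N).mulVec (Matrix.vecMul s G⁻¹)) : ℝ) : ℂ) / 2) := by
  have h := charFun_map_weightedSum (e := fun r : Fin M × Fin N => ε r.1 r.2)
    (fun r => hlaw r.1 r.2) (iIndepFun_design hindep M N)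
    (fun r => WithLp.toLp 2 ((√((M : ℝ) * N))⁻¹ • G⁻¹.mulVec (sensMatrix t x u₀ θ₀ M N r))) s
  refine h.trans ?_
  congr 5
  set g := Matrix.vecMul s G⁻¹ with hg
  have hin : ∀ r, inner ℝ (WithLp.toLp 2 ((√((M : ℝ) * N))⁻¹ •
      G⁻¹.mulVec (sensMatrix t x u₀ θ₀ M N r)) : Param k) s =
      (√((M : ℝ) * N))⁻¹ * (sensMatrix t x u₀ θ₀ M N).mulVec g r := fun r => by
    rw [EuclideanSpace.inner_eq_star_dotProduct]
    simp only [star_trivial]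
    rw [dotProduct_smul, Matrix.dotProduct_mulVec, ← hg, smul_eq_mul, Matrix.mulVec,
      dotProduct_comm]
  have hq : g ⬝ᵥ (gram t x u₀ θ₀ M N).mulVec g =
      ∑ r, (sensMatrix t x u₀ θ₀ M N).mulVec g r ^ 2 := by
    rw [gram, ← Matrix.mulVec_mulVec, Matrix.dotProduct_mulVec, Matrix.vecMul_transpose, dotProduct]
    exact Finset.sum_congr rfl fun _ _ => (pow_two _).symm
  rw [Matrix.smul_mulVec, dotProduct_smul, hq, smul_eq_mul, Finset.mul_sum]
  refine Finset.sum_congr rfl fun r _ => ?_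
  rw [hin, mul_pow, inv_pow, Real.sq_sqrt (by positivity)]

lemma tendsto_charFun_leadingTerm (hlaw : ∀ i j, HasLaw (ε i j) (gaussianReal 0 (η ^ 2)) P)
    (hindep : iIndepFun (fun ij : ℕ × ℕ => ε ij.1 ij.2) P) (hG : G.det ≠ 0)
    (hpos : G.PosSemidef)
    (hlim : Tendsto (fun MN : ℕ × ℕ => ((MN.1 : ℝ) * MN.2)⁻¹ • gram t x u₀ θ₀ MN.1 MN.2)
      (atTop ×ˢ atTop) (𝓝 G)) (s : Param k) :
    Tendsto (fun MN : ℕ × ℕ => charFun (P.map (leadingTerm t x G u₀ θ₀ ε MN.1 MN.2)) s)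
      (atTop ×ˢ atTop) (𝓝 (charFun (multivariateGaussian 0 (((η : ℝ) ^ 2) • G⁻¹)) s)) := by
  have hpos' : (((η : ℝ) ^ 2) • G⁻¹).PosSemidef := hpos.inv.smul (sq_nonneg _)
  simp only [charFun_leadingTerm t x hlaw hindep]
  rw [charFun_multivariateGaussian hpos']
  have hc : Continuous fun A : Matrix (Fin k) (Fin k) ℝ =>
      Complex.exp (-(((η : ℝ) ^ 2 * (Matrix.vecMul s G⁻¹ ⬝ᵥ
        A.mulVec (Matrix.vecMul s G⁻¹)) : ℝ) : ℂ) / 2) := by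
    refine Complex.continuous_exp.comp ((Complex.continuous_ofReal.comp ?_).neg.div_const 2)
    fun_prop
  -- The sandwich G⁻¹ G G⁻¹ in the limiting covariance collapses to G⁻¹.
  refine Eq.subst (motive := fun c => Tendsto _ _ (𝓝 c)) ?_ ((hc.tendsto G).comp hlim)
  rw [inner_zero_right, Matrix.smul_mulVec, dotProduct_smul, smul_eq_mul,
    Matrix.dotProduct_mulVec (Matrix.vecMul s G⁻¹), Matrix.vecMul_vecMul,
    Matrix.nonsing_inv_mul _ (isUnit_iff_ne_zero.2 hG), Matrix.vecMul_one,
    dotProduct_comm _ (Matrix.vecMul _ _), ← Matrix.dotProduct_mulVec]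
  simp [neg_div]

end LeadingTerm

/-! ### Asymptotic linearity of the estimator -/

section AsymptoticLinearity

variable {T X : Type*} (t : ∀ M : ℕ, Fin M → T) (x : ∀ N : ℕ, Fin N → X)
  {Ω : Type*} [MeasurableSpace Ω] {P : Measure Ω} [IsProbabilityMeasure P]
  {η : ℝ≥0} {ε : ℕ → ℕ → Ω → ℝ}

/-- Union bound; the `+ 1` in the share of `ρ` covers an empty index type. -/
lemma exists_measureReal_weighted_noise_family_le {J : Type*} [Fintype J]
    (hlaw : ∀ i j, HasLaw (ε i j) (gaussianReal 0 (η ^ 2)) P)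
    (hindep : iIndepFun (fun ij : ℕ × ℕ => ε ij.1 ij.2) P) {a : J → T × X → ℝ} {B : ℝ}
    (ha : ∀ j z, |a j z| ≤ B) {ρ : ℝ} (hρ : 0 < ρ) :
    ∃ L, 0 < L ∧ ∀ M N : ℕ, 0 < M → 0 < N →
      P.real {ω | ∃ j, L * √((M : ℝ) * N) ≤
        |∑ r : Fin M × Fin N, a j (gridPt t x M N r) * ε r.1 r.2 ω|} ≤ ρ := by
  have hρ' : 0 < ρ / (Fintype.card J + 1) := by positivity
  obtain ⟨L, hL, H⟩ := exists_measureReal_weighted_noise_le t x hlaw hindep B hρ'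
  refine ⟨L, hL, fun M N hM hN => ?_⟩
  have hU : {ω | ∃ j, L * √((M : ℝ) * N) ≤
      |∑ r : Fin M × Fin N, a j (gridPt t x M N r) * ε r.1 r.2 ω|} = ⋃ j, {ω | L * √((M : ℝ) * N) ≤
      |∑ r : Fin M × Fin N, a j (gridPt t x M N r) * ε r.1 r.2 ω|} := by
    ext ω
    simp
  rw [hU]
  refine (measureReal_iUnion_fintype_le _).trans
    ((Finset.sum_le_sum fun j _ => H (a j) (ha j) M N hM hN).trans ?_)
  rw [Finset.sum_const, Finset.card_univ, nsmul_eq_mul, ← mul_div_assoc,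
    div_le_iff₀ (by positivity)]
  nlinarith

variable [TopologicalSpace T] [MeasurableSpace T] [TopologicalSpace X]
  [MeasurableSpace X] {ν : Measure T} {χ : Measure X} {k : ℕ}
  {Θ Θad : Set (Param k)} {θ₀ : Param k} {u₀ : T × X → Param k → ℝ}
  {u : ℝ → T × X → Param k → ℝ} {p : ℝ} {θhat : ℕ → ℕ → ℝ → Ω → Param k}

/-- The normalized estimation error is asymptotically equal to its Gaussian leading term, as long
as the numerical error is negligible on the scale `(MN)^(-1/2)`. -/
lemma tendsto_measureReal_sub_leadingTerm (hΘ : IsOpen Θ) (hΘad : IsCompact Θad)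
    (hadΘ : Θad ⊆ Θ) (hθ₀ : θ₀ ∈ interior Θad) (hsmooth : SmoothInParam Θ u₀)
    (hsensint : ∀ l : Fin k, RiemannIntegrable (fun z => sens (u₀ z) l θ₀) (ν.prod χ))
    (hdiff : ∀ᶠ h in 𝓝[>] (0 : ℝ), ∀ z, DifferentiableOn ℝ (u h z) Θ)
    (horder : HasOrder (ν.prod χ) p Θ u u₀)
    (hsensorder : ∀ l : Fin k, HasOrder (ν.prod χ) p Θ
      (fun h z θ => sens (u h z) l θ) (fun z θ => sens (u₀ z) l θ))
    (hlaw : ∀ i j, HasLaw (ε i j) (gaussianReal 0 (η ^ 2)) P)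
    (hindep : iIndepFun (fun ij : ℕ × ℕ => ε ij.1 ij.2) P)
    (hθhat : ∀ᶠ h in 𝓝[>] (0 : ℝ), ∀ M N,
      ∀ᵐ ω ∂P, IsOLS t x (u h) Θad (data t x u₀ θ₀ ε M N ω) (θhat M N h ω))
    {G : Matrix (Fin k) (Fin k) ℝ} (hG : G.det ≠ 0)
    (hlim : Tendsto (fun MN : ℕ × ℕ => ((MN.1 : ℝ) * MN.2)⁻¹ • gram t x u₀ θ₀ MN.1 MN.2)
      (atTop ×ˢ atTop) (𝓝 G))
    (hcons : ∀ γ > 0, Tendsto (fun q : (ℕ × ℕ) × ℝ =>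
      P.real {ω | γ ≤ ‖θhat q.1.1 q.1.2 q.2 ω - θ₀‖}) ((atTop ×ˢ atTop) ×ˢ 𝓝[>] 0) (𝓝 0))
    {l : Filter ((ℕ × ℕ) × ℝ)} (hl : l ≤ (atTop ×ˢ atTop) ×ˢ 𝓝[>] 0)
    (hrate : Tendsto (fun q : (ℕ × ℕ) × ℝ => √((q.1.1 : ℝ) * q.1.2) * q.2 ^ p) l (𝓝 0))
    {γ : ℝ} (hγ : 0 < γ) :
    Tendsto (fun q : (ℕ × ℕ) × ℝ => P.real {ω | γ ≤
      ‖√((q.1.1 : ℝ) * q.1.2) • (θhat q.1.1 q.1.2 q.2 ω - θ₀) -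
        leadingTerm t x G u₀ θ₀ ε q.1.1 q.1.2 ω‖}) l (𝓝 0) := by
  have hθ₀Θ : θ₀ ∈ Θ := hadΘ (interior_subset hθ₀)
  refine Metric.tendsto_nhds.2 fun ρ hρ => ?_
  have hρ4 : 0 < ρ / 4 := by positivity
  -- bounds for the sensitivities
  choose B₁ hB₁ using fun l => (hsensint l).1
  obtain ⟨B₂, hB₂⟩ := hsmooth.exists_abs_sens_sens_le hΘ hθ₀Θ
  set B := ∑ l, |B₁ l| with hBdef
  have hB0 : 0 ≤ B := Finset.sum_nonneg fun _ _ => abs_nonneg _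
  have hB : ∀ l z, |sens (u₀ z) l θ₀| ≤ B := fun l z => (hB₁ l z).trans
    ((le_abs_self _).trans (Finset.single_le_sum (f := fun l => |B₁ l|)
      (fun _ _ => abs_nonneg _) (Finset.mem_univ l)))
  obtain ⟨C₁, h₁, hC₁, hh₁, H₁⟩ := horder.exists_abs_sub_le hadΘ hΘad
  obtain ⟨C₂, h₂, hC₂, hh₂, H₂⟩ := exists_abs_sens_sub_le hadΘ hΘad hsensorder
  -- tightness
  obtain ⟨L₁, hL₁, ht₁⟩ := exists_measureReal_sum_abs_noise_le hlaw hρ4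
  obtain ⟨L₂, hL₂, ht₂⟩ := exists_measureReal_weighted_noise_family_le t x (J := Fin k × Fin k)
    (a := fun j z => sens (sens (u₀ z) j.1) j.2 θ₀) hlaw hindep (fun j z => hB₂ j.1 j.2 z) hρ4
  obtain ⟨L₃, hL₃, ht₃⟩ := exists_measureReal_weighted_noise_family_le t x (J := Fin k)
    (a := fun j z => sens (u₀ z) j θ₀) hlaw hindep hB hρ4
  set L := L₁ + L₂ + L₃ with hLdef
  have hL : 0 ≤ L := by positivity
  -- the tolerance
  obtain ⟨c, hc, hcb⟩ := exists_norm_mulVec_le G⁻¹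
  set K : ℝ := k + k * L + L + B + 2 * k * B + 2 with hKdef
  have hK : 0 ≤ K := by positivity
  -- `κ * K` is the relative error of the linearized equations; the two smallness conditions allow
  -- solving them and put the final error below `γ`.
  obtain ⟨κ, hκ, hκ1, hκhalf, hκγ⟩ : ∃ κ > 0, κ ≤ 1 ∧ c * (κ * K) ≤ 1 / 2 ∧
      c * (κ * K) * (2 + 2 * c * L) < γ := by
    have hlim1 : Tendsto (fun κ : ℝ => c * (κ * K)) (𝓝[>] 0) (𝓝 0) := by
      have : Continuous fun κ : ℝ => c * (κ * K) := by fun_prop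
      simpa using (this.tendsto 0).mono_left nhdsWithin_le_nhds
    have hlim2 : Tendsto (fun κ : ℝ => c * (κ * K) * (2 + 2 * c * L)) (𝓝[>] 0) (𝓝 0) := by
      simpa using hlim1.mul_const (2 + 2 * c * L)
    have h1 : ∀ᶠ κ : ℝ in 𝓝[>] 0, 0 < κ ∧ κ < 1 := Ioo_mem_nhdsGT one_pos
    obtain ⟨κ, ⟨h1, h2⟩, h3, h4⟩ := (h1.and ((hlim1.eventually_lt_const one_half_pos).and
      (hlim2.eventually_lt_const hγ))).exists
    exact ⟨κ, h1, h2.le, h3.le, h4⟩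
  -- the neighbourhood on which the Taylor expansions hold
  have hnhds : ∀ᶠ θ in 𝓝 θ₀, θ ∈ interior Θad ∧
      (∀ z, |u₀ z θ - u₀ z θ₀ - ∑ m, (θ - θ₀) m * sens (u₀ z) m θ₀| ≤ κ * ‖θ - θ₀‖) ∧
      (∀ l z, |sens (u₀ z) l θ - sens (u₀ z) l θ₀ -
        ∑ m, (θ - θ₀) m * sens (sens (u₀ z) l) m θ₀| ≤ κ * ‖θ - θ₀‖) ∧
      (∀ z, ‖fderiv ℝ (u₀ z) θ - fderiv ℝ (u₀ z) θ₀‖ ≤ κ) := by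
    refine (isOpen_interior.eventually_mem hθ₀).and ((taylor_one_uniform hΘ hθ₀Θ
      (fun z => (hsmooth.1 z).differentiableOn (by norm_num))
      (fun κ hκ => hsmooth.eventually_norm_fderiv_sub_le hΘ hθ₀Θ hκ) hκ).and
      ((eventually_all.2 fun l => ?_).and (hsmooth.eventually_norm_fderiv_sub_le hΘ hθ₀Θ hκ)))
    exact taylor_one_uniform hΘ hθ₀Θ (fun z => hsmooth.differentiableOn_sens hΘ z l)
      (fun κ hκ => hsmooth.eventually_norm_fderiv_sens_sub_le hΘ hθ₀Θ l hκ) hκ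
  obtain ⟨δ, hδ, hball⟩ := Metric.eventually_nhds_iff_ball.1 hnhds
  set C := C₁ + C₂ with hCdef
  have hpow : ∀ᶠ h in 𝓝[>] (0 : ℝ), C * h ^ p < κ := by
    have := (tendsto_rpow_nhdsGT horder.1).const_mul C
    rw [mul_zero] at this
    exact this.eventually_lt_const hκ
  have hrateC : ∀ᶠ q : (ℕ × ℕ) × ℝ in l, C * (√((q.1.1 : ℝ) * q.1.2) * q.2 ^ p) < κ := by
    have := hrate.const_mul C
    rw [mul_zero] at this
    exact this.eventually_lt_const hκ
  have hgram : ∀ᶠ MN : ℕ × ℕ in atTop ×ˢ atTop, ∀ l m,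
      |(((MN.1 : ℝ) * MN.2)⁻¹ • gram t x u₀ θ₀ MN.1 MN.2) l m - G l m| ≤ κ := by
    refine eventually_all.2 fun l => eventually_all.2 fun m => ?_
    have := ((continuous_id.matrix_elem l m).tendsto G).comp hlim
    filter_upwards [Metric.tendsto_nhds.1 this κ hκ] with MN hMN using hMN.le
  filter_upwards [hrateC, hl ((hcons (min δ κ) (lt_min hδ hκ)).eventually_lt_const hρ4),
    hl ((eventually_pos_design.and hgram).prod_mk
      ((show ∀ᶠ h in 𝓝[>] (0 : ℝ), 0 < h ∧ h < h₁ from Ioo_mem_nhdsGT hh₁).and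
        ((show ∀ᶠ h in 𝓝[>] (0 : ℝ), 0 < h ∧ h < h₂ from Ioo_mem_nhdsGT hh₂).and
          (hpow.and (hdiff.and hθhat)))))] with q hq1 hq2 hq3
  obtain ⟨⟨⟨hM, hN⟩, hGq⟩, ⟨hh, hlt₁⟩, ⟨-, hlt₂⟩, hsmall, hdiffq, hols⟩ := hq3
  have hn0 : 0 < (q.1.1 : ℝ) * q.1.2 := by positivity
  have hsq := Real.sqrt_pos.2 hn0
  have hhp := Real.rpow_nonneg hh.le p
  rw [Real.dist_0_eq_abs, abs_of_nonneg measureReal_nonneg]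
  -- Outside four bad events, each of probability at most `ρ / 4`, the argument is deterministic:
  -- the estimator is near `θ₀`, and the absolute noise and both families of weighted sums are
  -- controlled.
  have hincl : P.real {ω | γ ≤ ‖√((q.1.1 : ℝ) * q.1.2) • (θhat q.1.1 q.1.2 q.2 ω - θ₀) -
        leadingTerm t x G u₀ θ₀ ε q.1.1 q.1.2 ω‖} ≤
      P.real ({ω | min δ κ ≤ ‖θhat q.1.1 q.1.2 q.2 ω - θ₀‖} ∪
        ({ω | L₁ * ((q.1.1 : ℝ) * q.1.2) ≤ ∑ r : Fin q.1.1 × Fin q.1.2, |ε r.1 r.2 ω|} ∪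
        ({ω | ∃ j : Fin k × Fin k, L₂ * √((q.1.1 : ℝ) * q.1.2) ≤ |∑ r : Fin q.1.1 × Fin q.1.2,
          sens (sens (u₀ (gridPt t x q.1.1 q.1.2 r)) j.1) j.2 θ₀ * ε r.1 r.2 ω|} ∪
        {ω | ∃ j : Fin k, L₃ * √((q.1.1 : ℝ) * q.1.2) ≤ |∑ r : Fin q.1.1 × Fin q.1.2,
          sens (u₀ (gridPt t x q.1.1 q.1.2 r)) j θ₀ * ε r.1 r.2 ω|}))) := by
    refine measureReal_le_of_ae_imp ?_
    filter_upwards [hols q.1.1 q.1.2] with ω hω hfar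
    by_contra hnot
    simp only [Set.mem_union, Set.mem_ofPred_eq, not_or, not_exists, not_le] at hnot
    obtain ⟨hn1, hn2, hn3, hn4⟩ := hnot
    set θ := θhat q.1.1 q.1.2 q.2 ω with hθ
    obtain ⟨hint, hT1, hT2, hT3⟩ := hball θ (by
      rw [Metric.mem_ball, dist_eq_norm]
      exact hn1.trans_le (min_le_left _ _))
    have hθad : θ ∈ Θad := interior_subset hint
    have hu : ∀ z, |u q.2 z θ - u₀ z θ| ≤ C * q.2 ^ p := fun z =>
      (H₁ q.2 hh hlt₁ θ hθad z).trans (mul_le_mul_of_nonneg_right (by linarith) hhp)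
    have hsu : ∀ l z, |sens (u q.2 z) l θ - sens (u₀ z) l θ| ≤ C * q.2 ^ p := fun l z =>
      (H₂ q.2 hh hlt₂ θ hθad l z).trans (mul_le_mul_of_nonneg_right (by linarith) hhp)
    have hlinear := abs_sqrt_smul_mulVec_sub_le (ι := Fin q.1.1 × Fin q.1.2)
      (e := fun r => ε r.1 r.2 ω)
      (d := fun r => u q.2 (gridPt t x q.1.1 q.1.2 r) θ - u₀ (gridPt t x q.1.1 q.1.2 r) θ₀)
      (S := fun r l => sens (u q.2 (gridPt t x q.1.1 q.1.2 r)) l θ)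
      (s := fun r l => sens (u₀ (gridPt t x q.1.1 q.1.2 r)) l θ₀)
      (a := fun r l m => sens (sens (u₀ (gridPt t x q.1.1 q.1.2 r)) l) m θ₀)
      (G := G) (Δ := θ - θ₀) (n := (q.1.1 : ℝ) * q.1.2) (κ := κ) (τ := C * q.2 ^ p) (B := B)
      (L := L) (by simp) hn0
      (hω.normal_equation t x hint
        (fun z => (hdiffq z).differentiableAt (hΘ.mem_nhds (hadΘ hθad))) hM hN)
      (fun r => by
        have e1 := hu (gridPt t x q.1.1 q.1.2 r)
        have e2 := hT1 (gridPt t x q.1.1 q.1.2 r)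
        rw [abs_le] at *
        constructor <;> linarith [e1.1, e1.2, e2.1, e2.2])
      (fun r l => by
        have e1 := hsu l (gridPt t x q.1.1 q.1.2 r)
        have e2 := hT2 l (gridPt t x q.1.1 q.1.2 r)
        rw [abs_le] at *
        constructor <;> linarith [e1.1, e1.2, e2.1, e2.2])
      (fun r l => by
        have e1 := hsu l (gridPt t x q.1.1 q.1.2 r)
        have e2 := (sens_sub_le _ l _ _).trans (hT3 (gridPt t x q.1.1 q.1.2 r))
        rw [abs_le] at *
        constructor <;> linarith [e1.1, e1.2, e2.1, e2.2])
      (fun r l => hB l _)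
      (hn2.le.trans (mul_le_mul_of_nonneg_right (by linarith) hn0.le))
      (fun l m => (hn3 (l, m)).le.trans
        (mul_le_mul_of_nonneg_right (by linarith) hsq.le))
      (fun l m => by
        have := hGq l m
        rwa [Matrix.smul_apply, gram_apply, smul_eq_mul] at this)
      hκ.le hκ1 (hn1.le.trans (min_le_right _ _)) (by positivity) hsmall.le
      (by rw [mul_left_comm]; exact hq1.le) hL hB0
    have hfinal := norm_sub_inv_mulVec_le hG hc hcb
      (v := √((q.1.1 : ℝ) * q.1.2) • (θ - θ₀))
      (ξ := fun l => (√((q.1.1 : ℝ) * q.1.2))⁻¹ * ∑ r : Fin q.1.1 × Fin q.1.2,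
        sens (u₀ (gridPt t x q.1.1 q.1.2 r)) l θ₀ * ε r.1 r.2 ω)
      (b := κ * K) (L := L) (by positivity) hL
      (fun l => by
        rw [norm_smul, Real.norm_of_nonneg hsq.le, WithLp.ofLp_smul, Matrix.mulVec_smul,
          Pi.smul_apply, smul_eq_mul]
        exact hlinear l)
      (fun l => by
        rw [abs_mul, abs_of_pos (inv_pos.2 hsq), inv_mul_le_iff₀ hsq, mul_comm]
        exact (hn4 l).le.trans (mul_le_mul_of_nonneg_right (by linarith) hsq.le))
      hκhalf
    rw [← leadingTerm_eq] at hfinal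
    exact absurd (le_trans hfar hfinal) (not_le.2 hκγ)
  have e1 := measureReal_union_le (μ := P)
    {ω | min δ κ ≤ ‖θhat q.1.1 q.1.2 q.2 ω - θ₀‖}
    ({ω | L₁ * ((q.1.1 : ℝ) * q.1.2) ≤ ∑ r : Fin q.1.1 × Fin q.1.2, |ε r.1 r.2 ω|} ∪
        ({ω | ∃ j : Fin k × Fin k, L₂ * √((q.1.1 : ℝ) * q.1.2) ≤ |∑ r : Fin q.1.1 × Fin q.1.2,
          sens (sens (u₀ (gridPt t x q.1.1 q.1.2 r)) j.1) j.2 θ₀ * ε r.1 r.2 ω|} ∪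
        {ω | ∃ j : Fin k, L₃ * √((q.1.1 : ℝ) * q.1.2) ≤ |∑ r : Fin q.1.1 × Fin q.1.2,
          sens (u₀ (gridPt t x q.1.1 q.1.2 r)) j θ₀ * ε r.1 r.2 ω|}))
  have e2 := (measureReal_union_le (μ := P) _ _).trans (add_le_add (ht₁ q.1.1 q.1.2 hM hN)
    ((measureReal_union_le (μ := P) _ _).trans
      (add_le_add (ht₂ q.1.1 q.1.2 hM hN) (ht₃ q.1.1 q.1.2 hM hN))))
  linarith

end AsymptoticLinearity

/-! ### Limits of the covariance of the numerical model -/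

section Scaling

variable {T X : Type*} {k : ℕ} (t : ∀ M : ℕ, Fin M → T) (x : ∀ N : ℕ, Fin N → X)
  {θ₀ : Param k} {u : ℝ → T × X → Param k → ℝ} {G : Matrix (Fin k) (Fin k) ℝ}

lemma tendsto_smul_covMat (hG : G.det ≠ 0)
    (hGh : Tendsto
      (fun q : (ℕ × ℕ) × ℝ => ((q.1.1 : ℝ) * q.1.2)⁻¹ • gram t x (u q.2) θ₀ q.1.1 q.1.2)
      ((atTop ×ˢ atTop) ×ˢ 𝓝[>] 0) (𝓝 G)) :
    Tendsto (fun q : (ℕ × ℕ) × ℝ => ((q.1.1 : ℝ) * q.1.2) • covMat t x (u q.2) θ₀ q.1.1 q.1.2)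
      ((atTop ×ˢ atTop) ×ˢ 𝓝[>] 0) (𝓝 G⁻¹) := by
  refine ((continuousAt_matrix_inv hG).tendsto.comp hGh).congr' ?_
  filter_upwards [tendsto_fst.eventually eventually_pos_design] with q hq
  exact (smul_covMat t x (u q.2) θ₀ hq.1 hq.2).symm

lemma tendsto_covMat_zero
    (hV : Tendsto
      (fun q : (ℕ × ℕ) × ℝ => ((q.1.1 : ℝ) * q.1.2) • covMat t x (u q.2) θ₀ q.1.1 q.1.2)
      ((atTop ×ˢ atTop) ×ˢ 𝓝[>] 0) (𝓝 G⁻¹)) :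
    Tendsto (fun q : (ℕ × ℕ) × ℝ => covMat t x (u q.2) θ₀ q.1.1 q.1.2)
      ((atTop ×ˢ atTop) ×ˢ 𝓝[>] 0) (𝓝 0) := by
  have hn : Tendsto (fun q : (ℕ × ℕ) × ℝ => ((q.1.1 : ℝ) * q.1.2)⁻¹)
      ((atTop ×ˢ atTop) ×ˢ 𝓝[>] 0) (𝓝 0) :=
    (((tendsto_natCast_atTop_atTop.comp tendsto_fst).atTop_mul_atTop₀
      (tendsto_natCast_atTop_atTop.comp tendsto_snd)).comp tendsto_fst).inv_tendsto_atTop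
  have h := hn.smul hV
  rw [zero_smul] at h
  refine h.congr' ?_
  filter_upwards [tendsto_fst.eventually eventually_pos_design] with q hq
  have h0 : ((q.1.1 : ℝ) * q.1.2) ≠ 0 := by have := hq.1; have := hq.2; positivity
  rw [smul_smul, inv_mul_cancel₀ h0, one_smul]

end Scaling

/-! ### Merging of laws -/

section Merging

variable {T X : Type*} {k : ℕ} (t : ∀ M : ℕ, Fin M → T) (x : ∀ N : ℕ, Fin N → X)
  {θ₀ : Param k} {u₀ : T × X → Param k → ℝ} {u : ℝ → T × X → Param k → ℝ}
  {G : Matrix (Fin k) (Fin k) ℝ} {Ω : Type*} [MeasurableSpace Ω] {P : Measure Ω}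
  [IsProbabilityMeasure P] {η : ℝ≥0} {ε : ℕ → ℕ → Ω → ℝ}

lemma tendsto_lawGap_scaled {l : Filter ((ℕ × ℕ) × ℝ)} [l.IsCountablyGenerated]
    {Y : (ℕ × ℕ) × ℝ → Ω → Param k} (hl : l ≤ (atTop ×ˢ atTop) ×ˢ 𝓝[>] 0)
    (hlaw : ∀ i j, HasLaw (ε i j) (gaussianReal 0 (η ^ 2)) P)
    (hindep : iIndepFun (fun ij : ℕ × ℕ => ε ij.1 ij.2) P) (hG : G.det ≠ 0)
    (hpos : G.PosSemidef)
    (hlim : Tendsto (fun MN : ℕ × ℕ => ((MN.1 : ℝ) * MN.2)⁻¹ • gram t x u₀ θ₀ MN.1 MN.2)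
      (atTop ×ˢ atTop) (𝓝 G))
    (hV : Tendsto
      (fun q : (ℕ × ℕ) × ℝ => ((q.1.1 : ℝ) * q.1.2) • covMat t x (u q.2) θ₀ q.1.1 q.1.2)
      ((atTop ×ˢ atTop) ×ˢ 𝓝[>] 0) (𝓝 G⁻¹))
    (hY : ∀ᶠ q in l, AEMeasurable (Y q) P)
    (hlead : ∀ γ > 0, Tendsto (fun q => P.real {ω | γ ≤
      ‖Y q ω - leadingTerm t x G u₀ θ₀ ε q.1.1 q.1.2 ω‖}) l (𝓝 0)) (f : Param k →ᵇ ℝ) :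
    Tendsto (fun q : (ℕ × ℕ) × ℝ => lawGap P (Y q)
      (multivariateGaussian 0 (((q.1.1 : ℝ) * q.1.2 * (η : ℝ) ^ 2) •
        covMat t x (u q.2) θ₀ q.1.1 q.1.2)) f) l (𝓝 0) := by
  have hS : Tendsto (fun q : (ℕ × ℕ) × ℝ => ((q.1.1 : ℝ) * q.1.2 * (η : ℝ) ^ 2) •
      covMat t x (u q.2) θ₀ q.1.1 q.1.2) l (𝓝 (((η : ℝ) ^ 2) • G⁻¹)) := by
    refine ((hV.mono_left hl).const_smul ((η : ℝ) ^ 2)).congr fun q => ?_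
    rw [smul_smul, mul_comm]
  have hgauss := tendsto_multivariateGaussian 0 hS
    (fun q => (posSemidef_covMat t x (u q.2) θ₀ _ _).smul (by positivity))
    (hpos.inv.smul (sq_nonneg (η : ℝ))) f
  have hchar : ∀ s, Tendsto (fun q : (ℕ × ℕ) × ℝ =>
      charFun (P.map (leadingTerm t x G u₀ θ₀ ε q.1.1 q.1.2)) s) l
      (𝓝 (charFun (multivariateGaussian 0 (((η : ℝ) ^ 2) • G⁻¹)) s)) := fun s =>
    (tendsto_charFun_leadingTerm t x hlaw hindep hG hpos hlim s).comp (tendsto_fst.mono_left hl)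
  exact tendsto_lawGap (fun q => aemeasurable_leadingTerm t x hlaw _ _) hY hchar hlead f hgauss

lemma tendsto_lawGap_of_consistent {Y : (ℕ × ℕ) × ℝ → Ω → Param k}
    (hV : Tendsto
      (fun q : (ℕ × ℕ) × ℝ => ((q.1.1 : ℝ) * q.1.2) • covMat t x (u q.2) θ₀ q.1.1 q.1.2)
      ((atTop ×ˢ atTop) ×ˢ 𝓝[>] 0) (𝓝 G⁻¹))
    (hmeas : ∀ᶠ q in (atTop ×ˢ atTop) ×ˢ 𝓝[>] 0, AEMeasurable (Y q) P)
    (hcons : ∀ γ > 0, Tendsto (fun q => P.real {ω | γ ≤ ‖Y q ω - θ₀‖})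
      ((atTop ×ˢ atTop) ×ˢ 𝓝[>] 0) (𝓝 0)) (f : Param k →ᵇ ℝ) :
    Tendsto (fun q : (ℕ × ℕ) × ℝ => lawGap P (Y q)
      (multivariateGaussian θ₀ (((η : ℝ) ^ 2) • covMat t x (u q.2) θ₀ q.1.1 q.1.2)) f)
      ((atTop ×ˢ atTop) ×ˢ 𝓝[>] 0) (𝓝 0) := by
  -- The common limit is the point mass at `θ₀`, the law of a constant, so consistency already is
  -- the required closeness in probability.
  have hdirac : multivariateGaussian θ₀ 0 = P.map fun _ => θ₀ := by
    simp [multivariateGaussian]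
  have hS := (tendsto_covMat_zero t x hV).const_smul ((η : ℝ) ^ 2)
  rw [smul_zero] at hS
  have hgauss := tendsto_multivariateGaussian θ₀ hS
    (fun q => (posSemidef_covMat t x (u q.2) θ₀ _ _).smul (sq_nonneg (η : ℝ)))
    Matrix.PosSemidef.zero f
  exact tendsto_lawGap (X := fun _ _ => θ₀) (fun _ => aemeasurable_const) hmeas
    (fun s => by rw [hdirac]; exact tendsto_const_nhds) hcons f hgauss

end Merging

end NumericalOLS

/-! ### Assembly of the theorem -/

open NumericalOLS in
theorem corollary1
    {T X : Type*}
    [MetricSpace T] [CompactSpace T] [MeasurableSpace T] [BorelSpace T]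
    [MetricSpace X] [CompactSpace X] [MeasurableSpace X] [BorelSpace X]
    (ν : Measure T) [IsFiniteMeasure ν] (χ : Measure X) [IsFiniteMeasure χ]
    {k : ℕ}
    -- the observation times and locations
    (t : ∀ M : ℕ, Fin M → T) (x : ∀ N : ℕ, Fin N → X)
    -- the parameter domain, the admissible set and the true parameter
    (Θ Θad : Set (NumericalOLS.Param k)) (hΘ : IsOpen Θ)
    (hΘad : IsCompact Θad) (hadΘ : Θad ⊆ Θ)
    (θ₀ : NumericalOLS.Param k) (hθ₀ : θ₀ ∈ interior Θad)
    -- the analytical solution and its standing regularity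
    (u₀ : T × X → NumericalOLS.Param k → ℝ)
    (hsmooth : NumericalOLS.SmoothInParam Θ u₀)
    (hu₀int : ∀ θ ∈ Θ, NumericalOLS.RiemannIntegrable (fun z => u₀ z θ) (ν.prod χ))
    (hsensint : ∀ l : Fin k,
      NumericalOLS.RiemannIntegrable (fun z => NumericalOLS.sens (u₀ z) l θ₀) (ν.prod χ))
    -- the numerical solution, of order `p` for the solution and for its sensitivities
    (u : ℝ → T × X → NumericalOLS.Param k → ℝ) (p : ℝ)
    (hdiff : ∀ᶠ h in 𝓝[>] (0 : ℝ), ∀ z, DifferentiableOn ℝ (u h z) Θ)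
    (horder : NumericalOLS.HasOrder (ν.prod χ) p Θ u u₀)
    (hsensorder : ∀ l : Fin k, NumericalOLS.HasOrder (ν.prod χ) p Θ
      (fun h z θ => NumericalOLS.sens (u h z) l θ) (fun z θ => NumericalOLS.sens (u₀ z) l θ))
    -- design averages converge; the limiting cost is uniquely minimized at the true parameter
    (hA1 : NumericalOLS.DesignConverges t x ν χ)
    (hA2 : ∀ θ ∈ Θad, θ ≠ θ₀ →
      NumericalOLS.limitCost ν χ u₀ θ₀ θ₀ < NumericalOLS.limitCost ν χ u₀ θ₀ θ)
    -- the sensitivities at the true parameter are asymptotically linearly independent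
    (hgram : (NumericalOLS.limitGram ν χ u₀ θ₀).det ≠ 0)
    -- i.i.d. Gaussian noise
    {Ω : Type*} [MeasurableSpace Ω] (P : Measure Ω) [IsProbabilityMeasure P]
    (η : ℝ≥0) (ε : ℕ → ℕ → Ω → ℝ)
    (hlaw : ∀ i j, HasLaw (ε i j) (gaussianReal 0 (η ^ 2)) P)
    (hindep : iIndepFun (fun ij : ℕ × ℕ => ε ij.1 ij.2) P)
    -- the numerical OLS estimator
    (θhat : ℕ → ℕ → ℝ → Ω → NumericalOLS.Param k)
    (hθhat : ∀ᶠ h in 𝓝[>] (0 : ℝ), ∀ M N, AEMeasurable (θhat M N h) P ∧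
      ∀ᵐ ω ∂P, NumericalOLS.IsOLS t x (u h) Θad
        (NumericalOLS.data t x u₀ θ₀ ε M N ω) (θhat M N h ω)) :
    -- `θhat` and `N(θ₀, η² V_h)` have asymptotically the same law as `M, N → ∞` and `h → 0`
    (∀ f : NumericalOLS.Param k →ᵇ ℝ,
      Tendsto (fun q : (ℕ × ℕ) × ℝ => NumericalOLS.lawGap P (θhat q.1.1 q.1.2 q.2)
          (multivariateGaussian θ₀
            (((η : ℝ) ^ 2) • NumericalOLS.covMat t x (u q.2) θ₀ q.1.1 q.1.2)) f)
        ((atTop ×ˢ atTop) ×ˢ 𝓝[>] (0 : ℝ)) (𝓝 0)) ∧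
    -- the same on the scale `(MN)^(-1/2)` of the standard deviations, `h → 0` before `M, N → ∞`
    (∀ f : NumericalOLS.Param k →ᵇ ℝ, ∀ δ : ℝ, 0 < δ →
      ∀ᶠ MN : ℕ × ℕ in atTop ×ˢ atTop, ∀ᶠ h in 𝓝[>] (0 : ℝ),
        NumericalOLS.lawGap P
          (fun ω => √((MN.1 : ℝ) * MN.2) • (θhat MN.1 MN.2 h ω - θ₀))
          (multivariateGaussian 0
            (((MN.1 : ℝ) * MN.2 * (η : ℝ) ^ 2) •
              NumericalOLS.covMat t x (u h) θ₀ MN.1 MN.2)) f < δ) ∧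
    -- the same, jointly, whenever the numerical error is negligible on that scale
    (∀ (M N : ℕ → ℕ) (h : ℕ → ℝ), Tendsto M atTop atTop → Tendsto N atTop atTop →
      Tendsto h atTop (𝓝[>] (0 : ℝ)) →
      Tendsto (fun n => √((M n : ℝ) * N n) * h n ^ p) atTop (𝓝 0) →
      ∀ f : NumericalOLS.Param k →ᵇ ℝ,
        Tendsto (fun n => NumericalOLS.lawGap P
          (fun ω => √((M n : ℝ) * N n) • (θhat (M n) (N n) (h n) ω - θ₀))
          (multivariateGaussian 0
            (((M n : ℝ) * N n * (η : ℝ) ^ 2) •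
              NumericalOLS.covMat t x (u (h n)) θ₀ (M n) (N n))) f) atTop (𝓝 0)) ∧
    -- the entries of `V_h` converge to those of `V` at the rate `O(h^p)`, for every design
    -- for which `V` exists
    (∀ M N : ℕ, (NumericalOLS.gram t x u₀ θ₀ M N).det ≠ 0 →
      (∀ᶠ h in 𝓝[>] (0 : ℝ), (NumericalOLS.gram t x (u h) θ₀ M N).det ≠ 0) ∧
      ∀ l m : Fin k,
        (fun h => NumericalOLS.covMat t x (u h) θ₀ M N l m - NumericalOLS.covMat t x u₀ θ₀ M N l m)
          =O[𝓝[>] (0 : ℝ)] fun h => h ^ p) ∧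
    -- and, after normalization by `MN`, uniformly over all large designs
    (∃ C h₀ : ℝ, 0 < h₀ ∧ ∀ᶠ MN : ℕ × ℕ in atTop ×ˢ atTop,
      (NumericalOLS.gram t x u₀ θ₀ MN.1 MN.2).det ≠ 0 ∧
      ∀ h, 0 < h → h < h₀ →
        (NumericalOLS.gram t x (u h) θ₀ MN.1 MN.2).det ≠ 0 ∧
        ∀ l m : Fin k,
          (MN.1 : ℝ) * MN.2 * |NumericalOLS.covMat t x (u h) θ₀ MN.1 MN.2 l m -
            NumericalOLS.covMat t x u₀ θ₀ MN.1 MN.2 l m| ≤ C * h ^ p) := by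
  have hθ₀ad : θ₀ ∈ Θad := interior_subset hθ₀
  have hp : 0 < p := horder.1
  obtain ⟨B, hB⟩ : ∃ B, ∀ l z, |sens (u₀ z) l θ₀| ≤ B := by
    choose B hB using fun l => (hsensint l).1
    exact ⟨∑ l, |B l|, fun l z => (hB l z).trans ((le_abs_self _).trans
      (Finset.single_le_sum (f := fun l => |B l|) (fun _ _ => abs_nonneg _) (Finset.mem_univ l)))⟩
  obtain ⟨C, h₀, hC, hh₀, H⟩ := exists_abs_gram_sub_le t x (hadΘ hθ₀ad) hp hB hsensorder
  have hlim := tendsto_smul_gram t x hA1 hsensint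
  generalize limitGram ν χ u₀ θ₀ = G at hlim hgram
  have hlimh := tendsto_smul_gram_numerical t x hp hh₀ H hlim
  have hGpos : G.PosSemidef := posSemidef_of_tendsto hlim fun MN =>
    (posSemidef_gram t x u₀ θ₀ MN.1 MN.2).smul (by positivity)
  have hV := tendsto_smul_covMat t x hgram hlimh
  have hols := hθhat.mono fun h hh M N => (hh M N).2
  have hcons := fun γ (hγ : γ > 0) => tendsto_measureReal_estimator_sub t x hΘ hΘad hadΘ hθ₀ad
    hsmooth hu₀int horder hA1 hA2 hlaw hindep hols hγ
  have hmeas : ∀ᶠ q : (ℕ × ℕ) × ℝ in (atTop ×ˢ atTop) ×ˢ 𝓝[>] 0,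
      AEMeasurable (θhat q.1.1 q.1.2 q.2) P :=
    tendsto_snd.eventually (hθhat.mono fun h hh => fun M N => (hh M N).1) |>.mono
      fun q hq => hq _ _
  -- The largest filter below the joint one along which √(MN) h^p → 0; it is countably generated, as
  -- Lévy's theorem requires.
  set l : Filter ((ℕ × ℕ) × ℝ) := ((atTop ×ˢ atTop) ×ˢ 𝓝[>] 0) ⊓
    comap (fun q : (ℕ × ℕ) × ℝ => √((q.1.1 : ℝ) * q.1.2) * q.2 ^ p) (𝓝 0) with hldef
  have hl : l ≤ (atTop ×ˢ atTop) ×ˢ 𝓝[>] 0 := inf_le_left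
  have hratel : Tendsto (fun q : (ℕ × ℕ) × ℝ => √((q.1.1 : ℝ) * q.1.2) * q.2 ^ p) l (𝓝 0) :=
    tendsto_comap.mono_left inf_le_right
  have hlead := fun γ (hγ : 0 < γ) => tendsto_measureReal_sub_leadingTerm t x hΘ hΘad hadΘ hθ₀
    hsmooth hsensint hdiff horder hsensorder hlaw hindep hols hgram hlim hcons hl hratel hγ
  have hscaled : ∀ f : Param k →ᵇ ℝ, Tendsto (fun q : (ℕ × ℕ) × ℝ => lawGap P
      (fun ω => √((q.1.1 : ℝ) * q.1.2) • (θhat q.1.1 q.1.2 q.2 ω - θ₀))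
      (multivariateGaussian 0 (((q.1.1 : ℝ) * q.1.2 * (η : ℝ) ^ 2) •
        covMat t x (u q.2) θ₀ q.1.1 q.1.2)) f) l (𝓝 0) := fun f =>
    tendsto_lawGap_scaled t x hl hlaw hindep hgram hGpos hlim hV
      ((hmeas.filter_mono hl).mono fun q hq =>
        (measurable_const_smul (√((q.1.1 : ℝ) * q.1.2))).comp_aemeasurable (hq.sub_const θ₀))
      hlead f
  refine ⟨fun f => ?_, fun f δ hδ => ?_, fun M N h hM hN hh hrate f => ?_,
    fun M N hdet => covMat_isBigO t x hp hh₀ H hdet,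
    exists_mul_abs_covMat_sub_le t x hgram hh₀ H hlim hlimh⟩
  · exact tendsto_lawGap_of_consistent t x hV hmeas hcons f
  · have hev := (hscaled f).eventually_lt_const hδ
    -- A set of `l` contains all large designs and small steps for which √(MN) h^p is small; for a
    -- fixed design the latter holds once `h` is small enough, which yields the iterated limit.
    obtain ⟨A, hA, S, hS, hAS⟩ := mem_inf_iff_superset.1 hev
    obtain ⟨s, hs, hsS⟩ := mem_comap.1 hS
    obtain ⟨pa, hpa, pb, hpb, hab⟩ := eventually_prod_iff.1 hA
    filter_upwards [hpa] with MN hMN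
    have hrate : Tendsto (fun h : ℝ => √((MN.1 : ℝ) * MN.2) * h ^ p) (𝓝[>] 0) (𝓝 0) := by
      simpa using (tendsto_rpow_nhdsGT hp).const_mul (√((MN.1 : ℝ) * MN.2))
    filter_upwards [hpb, hrate hs] with h hh hhs
    have hmem : ((MN, h) : (ℕ × ℕ) × ℝ) ∈ A ∩ S := ⟨hab hMN hh, hsS hhs⟩
    simpa only [Set.mem_ofPred_eq] using hAS hmem
  · have hq : Tendsto (fun n => ((M n, N n), h n)) atTop l :=
      tendsto_inf.2 ⟨(hM.prodMk hN).prodMk hh, tendsto_comap_iff.2 hrate⟩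
    have hcomp := (hscaled f).comp hq
    simp only [Function.comp_def] at hcomp
    exact hcomp
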